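/- Let $S_1,S_2\subset\mathbb{R}^3$ be compact smooth embedded submanifolds with (possibly empty) boundary, of dimensions $d_1=\dim S_1$ and $d_2=\dim S_2$ in $\{1,2\}$ with $d_1\neq d_2$. Assume that $S_1$ and $S_2$ are transversal, i.e. $T_pS_1+T_pS_2=\mathbb{R}^3$ for every $p\in S_1\cap S_2$ (at boundary points $T_pS_i$ is the full $d_i$-dimensional tangent space). For $i=1,2$ let $\theta_i\in L^\infty(S_i)$ with $\theta_i\ge c>0$ for some constant $c$, and let $\mu=\theta_1\mathcal{H}^{d_1}\llcorner S_1+\theta_2\mathcal{H}^{d_2}\llcorner S_2$, where $\mathcal{H}^d$ is the $d$-dimensional Hausdorff measure. For $x\in\mathbb{R}^3$ let $N_\mu(x)$ be the set of all values $\eta(x)$ of fields $\eta\in C_c^\infty(\mathbb{R}^3;\mathbb{R}^3)$ such that $\eta=\nabla v$ on $\operatorname{supp}\mu$ for some $v\in C_c^\infty(\mathbb{R}^3)$ with $v=0$ on $\operatorname{supp}\mu$. Let $T_\mu(x)$ be the orthogonal complement of $N_\mu(x)$, let $P_\mu(x)$ be the orthogonal projection of $\mathbb{R}^3$ onto $T_\mu(x)$,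 and for $\varphi\in C_c^\infty(\mathbb{R}^3)$ put $\nabla_\mu\varphi=P_\mu\nabla\varphi$. Let $H^1_\mu$ be the completion of $C_c^\infty(\mathbb{R}^3)$ in the norm $\big(\|\varphi\|_{L^2_\mu}^2+\|\nabla_\mu\varphi\|_{L^2_\mu}^2\big)^{1/2}$; a function $u\in L^2_\mu$ belongs to $H^1_\mu$ when there are $\varphi_n\in C_c^\infty(\mathbb{R}^3)$ such that $\varphi_n\to u$ in $L^2_\mu$ and $\nabla_\mu\varphi_n$ converges in $L^2_\mu$. Let $H^1(S_i)$ be the usual Sobolev space of the manifold $S_i$: the functions in $L^2(S_i)$ that, in suitable smooth charts (up to the boundary) around every point of $S_i$, are square-integrable together with their weak gradient. **Proposition.** For every $w\in H^1(S_1)$ the function $$u:=\begin{cases} w & \text{on } S_1,\\ 0 & \text{on } S_2\end{cases}$$ belongs to $H^1_\mu$, and for every $w\in H^1(S_2)$ the function $$v:=\begin{cases} 0 & \text{on } S_1,\\ w & \text{on } S_2\end{cases}$$ belongs to $H^1_\mu$. (The values on $S_1\cap S_2$, a $\mu$-null set, are irrelevant.) -/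

import Mathlib

open MeasureTheory Filter Topology
open scoped ContDiff ENNReal

noncomputable section

namespace LowDim

/-- The ambient space `ℝ³` with its Euclidean norm. -/
abbrev E3 : Type := EuclideanSpace ℝ (Fin 3)

/-! ### Compact smooth submanifolds with boundary -/

/-- The closed half-space of `ℝᵈ ⊆ ℝ³` (for `d = 1, 2`): the first coordinate is nonnegative and the
coordinates beyond the first `d` ones vanish. -/
def halfModel (d : ℕ) : Set E3 :=
  {y | 0 ≤ y 0 ∧ ∀ j : Fin 3, d ≤ (j : ℕ) → y j = 0}

/-- `Φ` is a smooth diffeomorphism between open subsets of `ℝ³` that flattens `S` to the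
`d`-dimensional half-space. Near an interior point of `S` the target of `Φ` may lie in the region
where the first coordinate is positive. -/
structure IsSliceChart (d : ℕ) (S : Set E3) (Φ : OpenPartialHomeomorph E3 E3) : Prop where
  smooth : ContDiffOn ℝ ∞ Φ Φ.source
  smooth_symm : ContDiffOn ℝ ∞ Φ.symm Φ.target
  slice : ∀ x ∈ Φ.source, x ∈ S ↔ Φ x ∈ halfModel d

/-- `S` is a compact `d`-dimensional smooth embedded submanifold of `ℝ³` with (possibly empty)
boundary. -/
structure IsCompactSubmanifold (d : ℕ) (S : Set E3) : Prop where
  isCompact : IsCompact S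
  exists_chart : ∀ p ∈ S, ∃ Φ : OpenPartialHomeomorph E3 E3, IsSliceChart d S Φ ∧ p ∈ Φ.source

/-- The tangent space of `S` at `p` (the full `d`-dimensional one, also at boundary points). -/
def tangentSpace (S : Set E3) (p : E3) : Submodule ℝ E3 :=
  Submodule.span ℝ (tangentConeAt ℝ S p)

/-- `S` and `T` are transversal: at every common point the tangent spaces span `ℝ³`. -/
def Transversal (S T : Set E3) : Prop :=
  ∀ p ∈ S ∩ T, tangentSpace S p ⊔ tangentSpace T p = ⊤

/-! ### The Sobolev space `H¹(S)` of a component -/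

/-- `d`-dimensional Hausdorff measure on `S`, normalised to be the surface measure. -/
def surfaceMeasure (d : ℕ) (S : Set E3) : Measure E3 :=
  (Measure.euclideanHausdorffMeasure d).restrict S

/-- `g ∈ H¹(D)` for an open `D ⊆ ℝᵈ`: `g` and its weak gradient `G` are square-integrable. -/
def MemH1Open {d : ℕ} (D : Set (EuclideanSpace ℝ (Fin d))) (g : EuclideanSpace ℝ (Fin d) → ℝ) :
    Prop :=
  MemLp g 2 (volume.restrict D) ∧
    ∃ G : EuclideanSpace ℝ (Fin d) → EuclideanSpace ℝ (Fin d),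
      MemLp G 2 (volume.restrict D) ∧
      ∀ φ : EuclideanSpace ℝ (Fin d) → ℝ, ContDiff ℝ ∞ φ → HasCompactSupport φ → tsupport φ ⊆ D →
        ∀ i : Fin d,
          ∫ y in D, g y * fderiv ℝ φ y (EuclideanSpace.single i 1) = -∫ y in D, G y i * φ y

/-- The inclusion `ℝᵈ → ℝ³` (for `d ≤ 3`) that appends zeros. -/
def pad (d : ℕ) (y : EuclideanSpace ℝ (Fin d)) : E3 :=
  WithLp.toLp 2 fun j : Fin 3 => if h : (j : ℕ) < d then y ⟨j, h⟩ else 0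

/-- The open subset of `ℝᵈ` that parametrises, through `Φ.symm ∘ pad d`, the interior points of the
submanifold in the domain of the slice chart `Φ`. -/
def chartDomain (d : ℕ) (Φ : OpenPartialHomeomorph E3 E3) : Set (EuclideanSpace ℝ (Fin d)) :=
  {y | pad d y ∈ Φ.target ∧ 0 < pad d y 0}

/-- `w ∈ H¹(S)` for a compact `d`-dimensional submanifold `S`: `w ∈ L²(S)`, and every point of `S`
(boundary points included) lies in a chart in which `w` is an `H¹` function. -/
def MemH1 (d : ℕ) (S : Set E3) (w : E3 → ℝ) : Prop :=
  MemLp w 2 (surfaceMeasure d S) ∧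
    ∀ p ∈ S, ∃ Φ : OpenPartialHomeomorph E3 E3, IsSliceChart d S Φ ∧ p ∈ Φ.source ∧
      MemH1Open (chartDomain d Φ) fun y => w (Φ.symm (pad d y))

/-! ### The tangent structure of a measure and the space `H¹_μ` -/

/-- The test functions `C_c^∞(ℝ³)`. -/
def IsTest (φ : E3 → ℝ) : Prop :=
  ContDiff ℝ ∞ φ ∧ HasCompactSupport φ

/-- The normal vectors `N_μ(x)`: the values at `x` of fields `η ∈ C_c^∞(ℝ³; ℝ³)` that agree on
`supp μ` with the gradient of some `v ∈ C_c^∞(ℝ³)` vanishing on `supp μ`. -/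
def normalVectors (μ : Measure E3) (x : E3) : Set E3 :=
  {ξ | ∃ η : E3 → E3, ContDiff ℝ ∞ η ∧ HasCompactSupport η ∧
    (∃ v : E3 → ℝ, IsTest v ∧ (∀ y ∈ μ.support, v y = 0) ∧ ∀ y ∈ μ.support, η y = gradient v y) ∧
    η x = ξ}

/-- The space `T_μ(x)` tangent to the measure `μ` at `x`. -/
def measureTangent (μ : Measure E3) (x : E3) : Submodule ℝ E3 :=
  (Submodule.span ℝ (normalVectors μ x))ᗮ

/-- The tangent gradient `∇_μ φ = P_μ ∇φ`, where `P_μ(x)` is the orthogonal projection onto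
`T_μ(x)`. -/
def muGradient (μ : Measure E3) (φ : E3 → ℝ) (x : E3) : E3 :=
  (measureTangent μ x).starProjection (gradient φ x)

/-- `u ∈ H¹_μ`, the completion of `C_c^∞(ℝ³)` for the norm `(‖φ‖²_{L²_μ} + ‖∇_μ φ‖²_{L²_μ})^{1/2}`,
realised as the closure of the pairs `(φ, ∇_μ φ)` in `L²_μ × L²_μ`: some test functions `φₙ` converge
to `u` in `L²_μ` while their tangent gradients converge in `L²_μ` to some field `ξ`. -/
def MemH1mu (μ : Measure E3) (u : E3 → ℝ) : Prop :=
  MemLp u 2 μ ∧ ∃ ξ : E3 → E3, MemLp ξ 2 μ ∧ ∃ φ : ℕ → E3 → ℝ, (∀ n, IsTest (φ n)) ∧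
    Tendsto (fun n => eLpNorm (fun x => φ n x - u x) 2 μ) atTop (𝓝 0) ∧
    Tendsto (fun n => eLpNorm (fun x => muGradient μ (φ n) x - ξ x) 2 μ) atTop (𝓝 0)

/-! ### Low-dimensional structures with two components -/

/-- `θ` is an admissible density on `S`: bounded, and bounded from below by a positive constant. -/
def IsDensity (d : ℕ) (S : Set E3) (θ : E3 → ℝ) : Prop :=
  AEMeasurable θ (surfaceMeasure d S) ∧
    ∃ c C : ℝ, 0 < c ∧ ∀ᵐ x ∂(surfaceMeasure d S), c ≤ θ x ∧ θ x ≤ C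

/-- The measure `θ 𝓗ᵈ⌞S`. -/
def weightedMeasure (d : ℕ) (S : Set E3) (θ : E3 → ℝ) : Measure E3 :=
  (surfaceMeasure d S).withDensity fun x => ENNReal.ofReal (θ x)

end LowDim

end

/-!
The tangent projection `P_μ` is a contraction, so it suffices to approximate the extension by zero in
the stronger sense of `AmbientH1`: test functions converging in `L²_μ` whose *full* gradients in `ℝ³`
converge in `L²_μ` to some field `ξ`. The tangent gradients then converge to `P_μ ξ`, which is
measurable because `‖P_μ(x) v‖` is the distance from `v` to `N_μ(x)`, an infimum of continuous
functions of `x` (`measurable_norm_starProjection`). Neither the exact form of `T_μ` nor the lower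
bound on the densities is needed. Since the densities are bounded above, `μ` may be replaced by the
sum of the two surface measures, and a partition of unity (`AmbientH1.of_locally`) reduces everything
to small balls.

On one component, a function of class `H¹` is mollified in a slice chart with a kernel displaced
towards the interior of the half-space, which gives smooth functions up to the boundary
(`MemH1Open.exists_smooth_approx`). Extended constantly in the transverse chart directions, they
become test functions on `ℝ³` whose full gradients converge (`ChartBall.ambientH1`).

Where the curve meets the surface, these approximations are multiplied by cutoffs equal to `1` on one
component and close to `0` in `H¹` on the other (`HasCutoffs`). They exist because a point has zero
capacity in a surface: if `q` denotes the two chart coordinates transverse to the curve, then `q = 0`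
on the curve, while transversality gives `|x - p| ≤ C |q x|` on the surface
(`Transversal.exists_norm_sub_le`). A plateau function `η` on the plane yields the cutoffs
`N⁻¹ ∑_{k<N} η(2ᵏ q)`: they are `1` near the curve, and their energy on the surface is `O(1/N)` by
quadratic growth of the surface measure (`hasCutoffs_of_chartBall`). Subtracting them from `1`
exchanges the roles of the curve and the surface (`HasCutoffs.symm`). A cutoff is chosen only after
the approximation that it multiplies, so no uniform bound on the approximations is required.
-/

open scoped NNReal

namespace LowDim

/-! ### Test functions and gradients -/

lemma gradient_eq_toDual_symm (f : E3 → ℝ) (x : E3) :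
    gradient f x = (InnerProductSpace.toDual ℝ E3).symm (fderiv ℝ f x) := rfl

lemma norm_gradient (f : E3 → ℝ) (x : E3) : ‖gradient f x‖ = ‖fderiv ℝ f x‖ := by
  rw [gradient_eq_toDual_symm, LinearIsometryEquiv.norm_map]

lemma IsTest.differentiable {φ : E3 → ℝ} (h : IsTest φ) : Differentiable ℝ φ :=
  h.1.differentiable (by simp)

lemma IsTest.add {φ ψ : E3 → ℝ} (h : IsTest φ) (h' : IsTest ψ) : IsTest (fun x => φ x + ψ x) :=
  ⟨h.1.add h'.1, h.2.add h'.2⟩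

lemma IsTest.mul {φ ψ : E3 → ℝ} (h : IsTest φ) (h' : IsTest ψ) : IsTest (fun x => φ x * ψ x) :=
  ⟨h.1.mul h'.1, h.2.mul_right⟩

lemma isTest_zero : IsTest (fun _ => 0) := ⟨contDiff_const, HasCompactSupport.zero⟩

lemma gradient_fun_add {φ ψ : E3 → ℝ} (h : Differentiable ℝ φ) (h' : Differentiable ℝ ψ) (x : E3) :
    gradient (fun x => φ x + ψ x) x = gradient φ x + gradient ψ x := by
  simp only [gradient_eq_toDual_symm]
  rw [fderiv_fun_add (h x) (h' x), map_add]

lemma gradient_fun_mul {φ ψ : E3 → ℝ} {x : E3} (h : DifferentiableAt ℝ φ x)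
    (h' : DifferentiableAt ℝ ψ x) :
    gradient (fun x => φ x * ψ x) x = φ x • gradient ψ x + ψ x • gradient φ x := by
  simp only [gradient_eq_toDual_symm]
  rw [fderiv_fun_mul h h', map_add, map_smul, map_smul]

lemma IsTest.continuous_gradient {φ : E3 → ℝ} (h : IsTest φ) : Continuous (gradient φ) :=
  (LinearIsometryEquiv.continuous _).comp (h.1.continuous_fderiv (by simp))

lemma IsTest.exists_bound {φ : E3 → ℝ} (h : IsTest φ) :
    ∃ M : ℝ, 0 < M ∧ (∀ x, ‖φ x‖ ≤ M) ∧ ∀ x, ‖gradient φ x‖ ≤ M := by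
  obtain ⟨A, hA⟩ := h.2.exists_bound_of_continuous h.1.continuous
  obtain ⟨B, hB⟩ := (h.2.fderiv (𝕜 := ℝ)).exists_bound_of_continuous
    (h.1.continuous_fderiv (by simp))
  refine ⟨max 1 (max A B), by positivity, fun x => (hA x).trans (by simp), fun x => ?_⟩
  rw [norm_gradient]
  exact (hB x).trans (by simp)

/-! ### Measurability of the tangent projection -/

/-- The normal vectors already form a linear subspace. -/
lemma coe_span_normalVectors (μ : Measure E3) (x : E3) :
    (Submodule.span ℝ (normalVectors μ x) : Set E3) = normalVectors μ x := by
  let N : Submodule ℝ E3 :=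
    { carrier := normalVectors μ x
      add_mem' := by
        rintro a b ⟨η, h1, h2, ⟨v, hv, hv0, hvη⟩, rfl⟩ ⟨η', h1', h2', ⟨v', hv', hv0', hvη'⟩, rfl⟩
        refine ⟨fun y => η y + η' y, h1.add h1', h2.add h2', ⟨fun y => v y + v' y, hv.add hv',
          fun y hy => by simp [hv0 y hy, hv0' y hy], fun y hy => ?_⟩, rfl⟩
        simp only [gradient_fun_add hv.differentiable hv'.differentiable, hvη y hy, hvη' y hy]
      zero_mem' := ⟨fun _ => 0, contDiff_const, HasCompactSupport.zero, ⟨fun _ => 0, isTest_zero,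
          fun _ _ => rfl, fun y _ => by simp [gradient_eq_toDual_symm]⟩, rfl⟩
      smul_mem' := by
        rintro c _ ⟨η, h1, h2, ⟨v, hv, hv0, hvη⟩, rfl⟩
        refine ⟨fun y => c • η y, h1.const_smul c, h2.smul_left (f := fun _ => c),
          ⟨fun y => c * v y, ⟨contDiff_const.mul hv.1, hv.2.mul_left⟩,
          fun y hy => by simp [hv0 y hy], fun y hy => ?_⟩, rfl⟩
        simp only [hvη y hy, gradient_eq_toDual_symm]
        rw [fderiv_const_mul (hv.differentiable y), map_smul] }
  exact congrArg _ (Submodule.span_eq N)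

/-- `‖P_μ(x) v‖` is the distance from `v` to `N_μ(x)`, an infimum of continuous functions of `x`,
hence upper semicontinuous. -/
lemma measurable_norm_starProjection (μ : Measure E3) (v : E3) :
    Measurable fun x => ‖(measureTangent μ x).starProjection v‖ := by
  refine measurable_of_Iio fun a => ?_
  have key : (fun x => ‖(measureTangent μ x).starProjection v‖) ⁻¹' Set.Iio a =
      ⋃ η ∈ {η : E3 → E3 | ContDiff ℝ ∞ η ∧ HasCompactSupport η ∧
        ∃ w : E3 → ℝ, IsTest w ∧ (∀ y ∈ μ.support, w y = 0) ∧
          ∀ y ∈ μ.support, η y = gradient w y}, {x | ‖v - η x‖ < a} := by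
    ext x
    simp only [Set.mem_preimage, Set.mem_Iio, Set.mem_iUnion, Set.mem_ofPred_eq, exists_prop]
    set N := Submodule.span ℝ (normalVectors μ x) with hN
    have hT : measureTangent μ x = Nᗮ := rfl
    constructor
    · intro h
      have hmem : N.starProjection v ∈ (N : Set E3) := N.starProjection_apply_mem v
      rw [hN, coe_span_normalVectors] at hmem
      obtain ⟨η, h1, h2, h3, h4⟩ := hmem
      refine ⟨η, ⟨h1, h2, h3⟩, ?_⟩
      rw [h4, ← hN]
      rwa [hT, Submodule.starProjection_orthogonal_val] at h
    · rintro ⟨η, ⟨h1, h2, h3⟩, h4⟩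
      have hmem : η x ∈ N := Submodule.subset_span ⟨η, h1, h2, h3, rfl⟩
      have h0 : Nᗮ.starProjection (η x) = 0 := by
        rw [Submodule.starProjection_orthogonal_val, Submodule.starProjection_eq_self_iff.2 hmem,
          sub_self]
      rw [hT]
      calc ‖Nᗮ.starProjection v‖ = ‖Nᗮ.starProjection (v - η x)‖ := by rw [map_sub, h0, sub_zero]
        _ ≤ ‖v - η x‖ := Submodule.norm_starProjection_apply_le _ _
        _ < a := h4
  rw [key]
  refine (isOpen_biUnion fun η hη => ?_).measurableSet
  exact isOpen_lt (continuous_const.sub hη.1.continuous).norm continuous_const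

lemma measurable_starProjection (μ : Measure E3) (v : E3) :
    Measurable fun x => (measureTangent μ x).starProjection v := by
  have key : ∀ w : E3, Measurable fun x => inner ℝ w ((measureTangent μ x).starProjection v) := by
    intro w
    have : (fun x => inner ℝ w ((measureTangent μ x).starProjection v)) = fun x =>
        (‖(measureTangent μ x).starProjection (w + v)‖ ^ 2 -
          ‖(measureTangent μ x).starProjection (w - v)‖ ^ 2) / 4 := by
      ext x
      set P := (measureTangent μ x).starProjection with hP
      have h1 : inner ℝ w (P v) = inner ℝ (P w) (P v) := by
        rw [hP, Submodule.inner_starProjection_left_eq_right, ← ContinuousLinearMap.comp_apply,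
          ← ContinuousLinearMap.mul_def, (Submodule.isIdempotentElem_starProjection _).eq]
      rw [h1, map_add, map_sub, norm_add_sq_real, norm_sub_sq_real]
      ring
    rw [this]
    exact (((measurable_norm_starProjection μ _).pow_const 2).sub
      ((measurable_norm_starProjection μ _).pow_const 2)).div_const 4
  have h2 : (fun x => (measureTangent μ x).starProjection v) = fun x =>
      WithLp.toLp 2 fun i => inner ℝ (EuclideanSpace.single i (1 : ℝ))
        ((measureTangent μ x).starProjection v) := by
    ext x i
    simp [EuclideanSpace.inner_single_left]
  rw [h2]
  exact (WithLp.measurable_toLp 2 _).comp (measurable_pi_lambda _ fun i => key _)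

lemma aestronglyMeasurable_starProjection (μ : Measure E3) {ν : Measure E3} {ξ : E3 → E3}
    (hξ : AEStronglyMeasurable ξ ν) :
    AEStronglyMeasurable (fun x => (measureTangent μ x).starProjection (ξ x)) ν := by
  have h : (fun x => (measureTangent μ x).starProjection (ξ x)) = fun x =>
      ∑ i, ξ x i • (measureTangent μ x).starProjection (EuclideanSpace.single i (1 : ℝ)) := by
    ext1 x
    conv_lhs => rw [← (EuclideanSpace.basisFun (Fin 3) ℝ).sum_repr (ξ x)]
    simp [map_sum]
  rw [h]
  refine Finset.aestronglyMeasurable_fun_sum _ fun i _ => ?_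
  exact ((EuclideanSpace.proj (𝕜 := ℝ) i).continuous.comp_aestronglyMeasurable hξ).smul
    (measurable_starProjection μ _).aestronglyMeasurable

/-! ### Approximation with ambient gradients -/

/-- `u` is a limit in `L²_ν` of test functions whose full ambient gradients converge in `L²_ν`. This
is stronger than membership in `H¹_ν`, which involves the tangential parts only. -/
def AmbientH1 (ν : Measure E3) (u : E3 → ℝ) : Prop :=
  MemLp u 2 ν ∧ ∃ ξ : E3 → E3, MemLp ξ 2 ν ∧ ∀ ε : ℝ≥0∞, 0 < ε → ∃ φ, IsTest φ ∧
    eLpNorm (fun x => φ x - u x) 2 ν ≤ ε ∧ eLpNorm (fun x => gradient φ x - ξ x) 2 ν ≤ ε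

lemma exists_pos_mul_le {C ε : ℝ≥0∞} (hC : C ≠ ⊤) (hε : 0 < ε) : ∃ δ, 0 < δ ∧ C * δ ≤ ε :=
  ⟨ε / C, ENNReal.div_pos hε.ne' hC, ENNReal.mul_div_le⟩

lemma IsTest.aestronglyMeasurable {φ : E3 → ℝ} (h : IsTest φ) (ν : Measure E3) :
    AEStronglyMeasurable φ ν := h.1.continuous.aestronglyMeasurable

lemma IsTest.aestronglyMeasurable_gradient {φ : E3 → ℝ} (h : IsTest φ) (ν : Measure E3) :
    AEStronglyMeasurable (gradient φ) ν := h.continuous_gradient.aestronglyMeasurable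

/-- The tangent projection is a contraction, so ambient convergence of gradients implies convergence
of the tangent gradients. -/
lemma AmbientH1.memH1mu {μ : Measure E3} {u : E3 → ℝ} (h : AmbientH1 μ u) : MemH1mu μ u := by
  obtain ⟨hu, ξ, hξ, happ⟩ := h
  have hle : ∀ (x v : E3), ‖(measureTangent μ x).starProjection v‖ ≤ ‖v‖ := fun x v =>
    Submodule.norm_starProjection_apply_le _ _
  refine ⟨hu, fun x => (measureTangent μ x).starProjection (ξ x),
    hξ.mono (aestronglyMeasurable_starProjection μ hξ.1) (ae_of_all _ fun x => hle _ _), ?_⟩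
  choose φ hφ h1 h2 using fun n : ℕ => happ ((n : ℝ≥0∞) + 1)⁻¹ (by simp)
  have hlim : Tendsto (fun n : ℕ => ((n : ℝ≥0∞) + 1)⁻¹) atTop (𝓝 0) := by
    have := (tendsto_add_atTop_iff_nat 1).2 ENNReal.tendsto_inv_nat_nhds_zero
    simpa using this
  refine ⟨φ, hφ, tendsto_of_tendsto_of_tendsto_of_le_of_le tendsto_const_nhds hlim
    (fun _ => zero_le) h1, tendsto_of_tendsto_of_tendsto_of_le_of_le tendsto_const_nhds hlim
    (fun _ => zero_le) fun n => le_trans (eLpNorm_mono fun x => ?_) (h2 n)⟩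
  rw [muGradient, ← map_sub]
  exact hle _ _

lemma AmbientH1.congr_ae {ν : Measure E3} {u u' : E3 → ℝ} (h : AmbientH1 ν u) (huu' : u =ᵐ[ν] u') :
    AmbientH1 ν u' := by
  obtain ⟨hu, ξ, hξ, happ⟩ := h
  refine ⟨hu.ae_eq huu', ξ, hξ, fun ε hε => ?_⟩
  obtain ⟨φ, h1, h2, h3⟩ := happ ε hε
  refine ⟨φ, h1, (eLpNorm_congr_ae ?_).trans_le h2, h3⟩
  filter_upwards [huu'] with x hx
  rw [hx]

lemma AmbientH1.of_le_smul {μ ν : Measure E3} {u : E3 → ℝ} {C : ℝ≥0∞} (hC : C ≠ ⊤)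
    (h : AmbientH1 ν u) (hle : μ ≤ C • ν) : AmbientH1 μ u := by
  obtain ⟨hu, ξ, hξ, happ⟩ := h
  refine ⟨hu.of_measure_le_smul hC hle, ξ, hξ.of_measure_le_smul hC hle, fun ε hε => ?_⟩
  obtain ⟨δ, hδ, hδε⟩ := exists_pos_mul_le (C := C ^ (1 / (2 : ℝ≥0∞)).toReal)
    (ENNReal.rpow_ne_top_of_nonneg (by positivity) hC) hε
  obtain ⟨φ, h1, h2, h3⟩ := happ δ hδ
  refine ⟨φ, h1, ?_, ?_⟩ <;>
  · refine (eLpNorm_mono_measure _ hle).trans ?_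
    rw [eLpNorm_smul_measure_of_ne_top (by simp), smul_eq_mul]
    refine le_trans (mul_le_mul_right ?_ _) hδε
    assumption

lemma ambientH1_zero (ν : Measure E3) : AmbientH1 ν (fun _ => 0) :=
  ⟨MemLp.zero', fun _ => 0, MemLp.zero', fun ε hε => ⟨fun _ => 0, isTest_zero, by simp,
    by simp [gradient_eq_toDual_symm]⟩⟩

lemma AmbientH1.add {ν : Measure E3} {u v : E3 → ℝ} (hu : AmbientH1 ν u) (hv : AmbientH1 ν v) :
    AmbientH1 ν (fun x => u x + v x) := by
  obtain ⟨hu, ξ, hξ, happ⟩ := hu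
  obtain ⟨hv, η, hη, happ'⟩ := hv
  refine ⟨hu.add hv, fun x => ξ x + η x, hξ.add hη, fun ε hε => ?_⟩
  obtain ⟨φ, h1, h2, h3⟩ := happ (ε / 2) (ENNReal.half_pos hε.ne')
  obtain ⟨ψ, h1', h2', h3'⟩ := happ' (ε / 2) (ENNReal.half_pos hε.ne')
  refine ⟨_, h1.add h1', ?_, ?_⟩
  · calc _ = eLpNorm ((fun x => φ x - u x) + fun x => ψ x - v x) 2 ν := by
          congr 1; ext x; simp; ring
      _ ≤ _ := eLpNorm_add_le ((h1.aestronglyMeasurable ν).sub hu.1)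
          ((h1'.aestronglyMeasurable ν).sub hv.1) (by norm_num)
      _ ≤ ε / 2 + ε / 2 := add_le_add h2 h2'
      _ = ε := ENNReal.add_halves ε
  · calc _ = eLpNorm ((fun x => gradient φ x - ξ x) + fun x => gradient ψ x - η x) 2 ν := by
          congr 1; ext1 x
          rw [gradient_fun_add h1.differentiable h1'.differentiable]; simp only [Pi.add_apply]
          abel
      _ ≤ _ := eLpNorm_add_le ((h1.aestronglyMeasurable_gradient ν).sub hξ.1)
          ((h1'.aestronglyMeasurable_gradient ν).sub hη.1) (by norm_num)
      _ ≤ ε / 2 + ε / 2 := add_le_add h3 h3'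
      _ = ε := ENNReal.add_halves ε

lemma AmbientH1.finset_sum {ν : Measure E3} {ι : Type*} (s : Finset ι) {u : ι → E3 → ℝ}
    (hu : ∀ i ∈ s, AmbientH1 ν (u i)) : AmbientH1 ν (fun x => ∑ i ∈ s, u i x) := by
  classical
  induction s using Finset.induction_on with
  | empty => simpa using ambientH1_zero ν
  | insert i s hi ih =>
    simp only [Finset.sum_insert hi]
    exact (hu i (by simp)).add (ih fun j hj => hu j (by simp [hj]))

/-- Bounded multiplication: an `L²` bound for a function dominated by a combination of two others. -/
lemma eLpNorm_le_mul_add {ν : Measure E3} {F G H : Type*} [NormedAddCommGroup F]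
    [NormedAddCommGroup G] [NormedAddCommGroup H] {f : E3 → F} {g : E3 → G} {h : E3 → H} {M : ℝ}
    (hg : AEStronglyMeasurable g ν) (hh : AEStronglyMeasurable h ν)
    (hle : ∀ᵐ x ∂ν, ‖f x‖ ≤ M * (‖g x‖ + ‖h x‖)) :
    eLpNorm f 2 ν ≤ ENNReal.ofReal M * (eLpNorm g 2 ν + eLpNorm h 2 ν) := by
  calc eLpNorm f 2 ν ≤ ENNReal.ofReal M * eLpNorm (fun x => ‖g x‖ + ‖h x‖) 2 ν := by
        refine eLpNorm_le_mul_eLpNorm_of_ae_le_mul (hle.mono fun x hx => ?_) 2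
        rwa [Real.norm_of_nonneg (r := ‖g x‖ + ‖h x‖) (by positivity)]
    _ ≤ _ := by
        gcongr
        refine (eLpNorm_add_le hg.norm hh.norm (by norm_num)).trans ?_
        rw [eLpNorm_norm, eLpNorm_norm]

/-- A bump function supported in the open set `U` turns an approximation on `U` into a global one. -/
lemma AmbientH1.bump_mul {ν : Measure E3} {U : Set E3} (hU : MeasurableSet U) {u χ : E3 → ℝ}
    (hu : MemLp u 2 ν) (h : AmbientH1 (ν.restrict U) u) (hχ : IsTest χ) (hχU : tsupport χ ⊆ U) :
    AmbientH1 ν (fun x => χ x * u x) := by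
  obtain ⟨M, hM, hMχ, hMg⟩ := hχ.exists_bound
  obtain ⟨-, ξ, hξ, happ⟩ := h
  have hχ0 : ∀ x, x ∉ U → χ x = 0 := fun x hx => image_eq_zero_of_notMem_tsupport fun h => hx (hχU h)
  have hg0 : ∀ x, x ∉ U → gradient χ x = 0 := fun x hx => by
    have : fderiv ℝ χ x = 0 :=
      image_eq_zero_of_notMem_tsupport fun h => hx (hχU (tsupport_fderiv_subset ℝ h))
    rw [gradient_eq_toDual_symm, this, map_zero]
  have hξ' : MemLp (U.indicator ξ) 2 ν := (memLp_indicator_iff_restrict hU).2 hξ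
  have hχu : MemLp (fun x => χ x * u x) 2 ν :=
    hu.of_le_mul (c := M) ((hχ.aestronglyMeasurable ν).mul hu.1)
      (ae_of_all _ fun x => by rw [norm_mul]; gcongr; exact hMχ x)
  refine ⟨hχu, fun x => χ x • U.indicator ξ x + u x • gradient χ x, ?_, fun ε hε => ?_⟩
  · refine MemLp.add (hξ'.of_le_mul (c := M) ((hχ.aestronglyMeasurable ν).smul hξ'.1)
      (ae_of_all _ fun x => ?_)) (hu.of_le_mul (c := M)
        (hu.1.smul (hχ.aestronglyMeasurable_gradient ν)) (ae_of_all _ fun x => ?_))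
    · simp only [norm_smul]; gcongr; exact hMχ x
    · simp only [norm_smul]; rw [mul_comm]; gcongr; exact hMg x
  · obtain ⟨δ, hδ, hδε⟩ := exists_pos_mul_le (C := ENNReal.ofReal M * 2)
      (by finiteness) hε
    obtain ⟨φ, h1, h2, h3⟩ := happ δ hδ
    rw [← eLpNorm_indicator_eq_eLpNorm_restrict hU] at h2 h3
    have m1 : AEStronglyMeasurable (U.indicator fun x => φ x - u x) ν :=
      ((h1.aestronglyMeasurable ν).sub hu.1).indicator hU
    have m2 : AEStronglyMeasurable (U.indicator fun x => gradient φ x - ξ x) ν := by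
      refine AEStronglyMeasurable.congr (((h1.aestronglyMeasurable_gradient ν).indicator hU).sub
        hξ'.1) (ae_of_all _ fun x => ?_)
      by_cases hx : x ∈ U <;> simp [hx]
    have fin : ENNReal.ofReal M * (eLpNorm (U.indicator fun x => gradient φ x - ξ x) 2 ν +
        eLpNorm (U.indicator fun x => φ x - u x) 2 ν) ≤ ε :=
      calc _ ≤ ENNReal.ofReal M * (δ + δ) := by gcongr
        _ = ENNReal.ofReal M * 2 * δ := by ring
        _ ≤ ε := hδε
    refine ⟨_, hχ.mul h1, le_trans (eLpNorm_le_mul_add m2 m1 (ae_of_all _ fun x => ?_)) fin,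
      le_trans (eLpNorm_le_mul_add m2 m1 (ae_of_all _ fun x => ?_)) fin⟩
    · by_cases hx : x ∈ U
      · rw [← mul_sub, norm_mul, Set.indicator_of_mem hx (f := fun x => φ x - u x)]
        have := hMχ x
        gcongr
        exact le_add_of_nonneg_left (norm_nonneg _)
      · simp [hχ0 x hx, hx]
    · by_cases hx : x ∈ U
      · simp only [gradient_fun_mul (hχ.differentiable x) (h1.differentiable x),
          Set.indicator_of_mem hx]
        have e : χ x • gradient φ x + φ x • gradient χ x - (χ x • ξ x + u x • gradient χ x) =
          χ x • (gradient φ x - ξ x) + (φ x - u x) • gradient χ x := by module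
        rw [e, mul_add]
        refine (norm_add_le _ _).trans (add_le_add ?_ ?_)
        · rw [norm_smul]; gcongr; exact hMχ x
        · rw [norm_smul, mul_comm]; gcongr; exact hMg x
      · simp [gradient_fun_mul (hχ.differentiable x) (h1.differentiable x), hχ0 x hx, hg0 x hx, hx]

/-- Membership is local on a compact set that carries the measure. -/
lemma AmbientH1.of_locally {ν : Measure E3} {K : Set E3} (hK : IsCompact K) (hνK : ∀ᵐ x ∂ν, x ∈ K)
    {u : E3 → ℝ} (hu : MemLp u 2 ν)
    (h : ∀ p ∈ K, ∃ r > 0, AmbientH1 (ν.restrict (Metric.ball p r)) u) : AmbientH1 ν u := by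
  choose! r hr0 hr using h
  obtain ⟨t, htK⟩ := hK.elim_nhds_subcover' (fun p _ => Metric.ball p (r p))
    fun p hp => Metric.ball_mem_nhds p (hr0 p hp)
  let U : t → Set E3 := fun i => Metric.ball (i : K) (r (i : K))
  obtain ⟨f, hf⟩ := SmoothPartitionOfUnity.exists_isSubordinate (modelWithCornersSelf ℝ E3)
    hK.isClosed U (fun i => Metric.isOpen_ball) (fun x hx => by
      have hx' := htK hx
      simp only [Set.mem_iUnion] at hx'
      obtain ⟨i, hi, hxi⟩ := hx'
      exact Set.mem_iUnion.2 ⟨⟨i, hi⟩, hxi⟩)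
  have htest : ∀ i, IsTest (f i) := fun i =>
    ⟨(f i).contMDiff.contDiff, Metric.isCompact_of_isClosed_isBounded (isClosed_tsupport _)
      (Metric.isBounded_ball.subset (hf i))⟩
  refine (AmbientH1.finset_sum Finset.univ (u := fun i x => f i x * u x) fun i _ =>
    AmbientH1.bump_mul Metric.isOpen_ball.measurableSet hu (hr _ (i : K).2) (htest i)
      (hf i)).congr_ae ?_
  filter_upwards [hνK] with x hx
  rw [← Finset.sum_mul, ← finsum_eq_sum_of_fintype, f.sum_eq_one hx, one_mul]

/-! ### Cutoffs and extension by zero -/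

lemma eLpNorm_add_measure_le {F : Type*} [NormedAddCommGroup F] (f : E3 → F) (ν τ : Measure E3) :
    eLpNorm f 2 (ν + τ) ≤ eLpNorm f 2 ν + eLpNorm f 2 τ := by
  simp only [eLpNorm_eq_lintegral_rpow_enorm_toReal (p := 2) (by norm_num) (by norm_num),
    lintegral_add_measure]
  exact ENNReal.rpow_add_le_add_rpow _ _ (by norm_num) (by norm_num)

lemma MemLp.add_measure {F : Type*} [NormedAddCommGroup F] {f : E3 → F} {ν τ : Measure E3}
    (hν : MemLp f 2 ν) (hτ : MemLp f 2 τ) : MemLp f 2 (ν + τ) :=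
  ⟨hν.1.add_measure hτ.1, (eLpNorm_add_measure_le f ν τ).trans_lt (ENNReal.add_lt_top.2 ⟨hν.2, hτ.2⟩)⟩

/-- There are test functions close in `L²` to `1` on `ν` and to `0` on `τ` whose full gradients are
small in `L²` of both measures: the common part of the two carriers has zero capacity in one of
them. -/
def HasCutoffs (ν τ : Measure E3) : Prop :=
  ∀ ε : ℝ≥0∞, 0 < ε → ∃ κ, IsTest κ ∧ eLpNorm (fun x => κ x - 1) 2 ν ≤ ε ∧
    eLpNorm (gradient κ) 2 ν ≤ ε ∧ eLpNorm κ 2 τ ≤ ε ∧ eLpNorm (gradient κ) 2 τ ≤ ε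

lemma exists_isTest_one_on_ball (p : E3) (r : ℝ) :
    ∃ χ, IsTest χ ∧ ∀ x ∈ Metric.ball p r, χ x = 1 ∧ gradient χ x = 0 := by
  let f : ContDiffBump p := ⟨max r 1, max r 1 + 1, by positivity, by linarith⟩
  refine ⟨f, ⟨f.contDiff, f.hasCompactSupport⟩, fun x hx => ?_⟩
  have hx' : x ∈ Metric.ball p f.rIn := Metric.ball_subset_ball (le_max_left _ _) hx
  refine ⟨f.one_of_mem_closedBall (Metric.ball_subset_closedBall hx'), ?_⟩
  have : (f : E3 → ℝ) =ᶠ[𝓝 x] fun _ => 1 := by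
    filter_upwards [Metric.isOpen_ball.mem_nhds hx'] with y hy
    exact f.one_of_mem_closedBall (Metric.ball_subset_closedBall hy)
  rw [gradient_eq_toDual_symm, this.fderiv_eq]
  simp

lemma HasCutoffs.symm {ν τ : Measure E3} {p : E3} {r : ℝ} (h : HasCutoffs ν τ)
    (hν : ∀ᵐ x ∂ν, x ∈ Metric.ball p r) (hτ : ∀ᵐ x ∂τ, x ∈ Metric.ball p r) : HasCutoffs τ ν := by
  intro ε hε
  obtain ⟨κ, h0, h1, h2, h3, h4⟩ := h ε hε
  obtain ⟨χ, hχ, hχ1⟩ := exists_isTest_one_on_ball p r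
  have hκ : IsTest (fun x => (-1) * κ x) := ⟨contDiff_const.mul h0.1, h0.2.mul_left⟩
  have hgrad : ∀ x ∈ Metric.ball p r, gradient (fun x => χ x + (-1) * κ x) x = - gradient κ x := by
    intro x hx
    rw [gradient_fun_add hχ.differentiable hκ.differentiable, (hχ1 x hx).2, zero_add]
    simp only [gradient_eq_toDual_symm]
    rw [fderiv_const_mul (h0.differentiable x), map_smul, neg_one_smul]
  refine ⟨_, hχ.add hκ, ?_, ?_, ?_, ?_⟩
  · refine (eLpNorm_congr_norm_ae (hτ.mono fun x hx => ?_)).trans_le h3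
    rw [(hχ1 x hx).1, ← norm_neg]; congr 1; ring
  · refine (eLpNorm_congr_norm_ae (hτ.mono fun x hx => ?_)).trans_le h4
    rw [hgrad x hx, norm_neg]
  · refine (eLpNorm_congr_norm_ae (hν.mono fun x hx => ?_)).trans_le h1
    rw [(hχ1 x hx).1, ← norm_neg]; congr 1; ring
  · refine (eLpNorm_congr_norm_ae (hν.mono fun x hx => ?_)).trans_le h2
    rw [hgrad x hx, norm_neg]

/-- Multiplying approximations on `ν` by cutoffs that vanish on `τ` gives approximations of the
extension by zero. -/
lemma AmbientH1.extend_zero {ν τ : Measure E3} {S : Set E3}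
    (hνS : ∀ᵐ x ∂ν, x ∈ S) (hτS : ∀ᵐ x ∂τ, x ∉ S) {w u : E3 → ℝ} (hw : AmbientH1 ν w)
    (huν : u =ᵐ[ν] w) (huτ : u =ᵐ[τ] fun _ => 0) (hcut : HasCutoffs ν τ) :
    AmbientH1 (ν + τ) u := by
  obtain ⟨hw2, ξ, hξ, happ⟩ := hw
  have hξν : S.indicator ξ =ᵐ[ν] ξ := hνS.mono fun x hx => Set.indicator_of_mem hx _
  have hξτ : S.indicator ξ =ᵐ[τ] fun _ => 0 := hτS.mono fun x hx => Set.indicator_of_notMem hx _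
  refine ⟨MemLp.add_measure (hw2.ae_eq huν.symm) (MemLp.zero'.ae_eq huτ.symm), S.indicator ξ,
    MemLp.add_measure (hξ.ae_eq hξν.symm) (MemLp.zero'.ae_eq hξτ.symm), fun ε hε => ?_⟩
  have hε4 : 0 < ε / 2 / 2 := ENNReal.half_pos (ENNReal.half_pos hε.ne').ne'
  have hε42 : ε / 2 / 2 ≤ ε / 2 := ENNReal.half_le_self
  obtain ⟨φ, hφ, h1, h2⟩ := happ (ε / 2 / 2) hε4
  -- the cutoff is chosen after `φ`, whose bound `M` is not uniform in the approximation
  obtain ⟨M, hM, hMφ, hMg⟩ := hφ.exists_bound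
  obtain ⟨δ, hδ, hδε⟩ := exists_pos_mul_le (C := ENNReal.ofReal M * 2) (by finiteness) hε4
  obtain ⟨κ, hκ, k1, k2, k3, k4⟩ := hcut δ hδ
  have small : ∀ a b : ℝ≥0∞, a ≤ δ → b ≤ δ → ENNReal.ofReal M * (a + b) ≤ ε / 2 / 2 :=
    fun a b ha hb => calc
      _ ≤ ENNReal.ofReal M * (δ + δ) := by gcongr
      _ = ENNReal.ofReal M * 2 * δ := by ring
      _ ≤ _ := hδε
  have mκ1 : ∀ m : Measure E3, AEStronglyMeasurable (fun x => κ x - 1) m := fun m =>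
    (hκ.aestronglyMeasurable m).sub aestronglyMeasurable_const
  have mκg := hκ.aestronglyMeasurable_gradient
  have hgrad : ∀ x, gradient (fun x => φ x * κ x) x = φ x • gradient κ x + κ x • gradient φ x :=
    fun x => gradient_fun_mul (hφ.differentiable x) (hκ.differentiable x)
  refine ⟨_, hφ.mul hκ, ?_, ?_⟩ <;>
    rw [← ENNReal.add_halves ε] <;>
    refine (eLpNorm_add_measure_le _ ν τ).trans (add_le_add ?_ ?_)
  · calc eLpNorm (fun x => φ x * κ x - u x) 2 ν
        = eLpNorm ((fun x => φ x * (κ x - 1)) + fun x => φ x - w x) 2 ν := by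
          refine eLpNorm_congr_ae (huν.mono fun x hx => ?_)
          simp only [Pi.add_apply]
          rw [hx]; ring
      _ ≤ eLpNorm (fun x => φ x * (κ x - 1)) 2 ν + eLpNorm (fun x => φ x - w x) 2 ν :=
          eLpNorm_add_le ((hφ.aestronglyMeasurable ν).mul (mκ1 ν))
            ((hφ.aestronglyMeasurable ν).sub hw2.1) (by norm_num)
      _ ≤ ε / 2 / 2 + ε / 2 / 2 := by
          refine add_le_add ?_ h1
          refine (eLpNorm_le_mul_add (mκ1 ν) (mκg ν)
            (ae_of_all _ fun x => ?_)).trans (small _ _ k1 k2)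
          rw [norm_mul]
          gcongr
          · exact hMφ x
          · exact le_add_of_nonneg_right (norm_nonneg _)
      _ = ε / 2 := ENNReal.add_halves _
  · refine (eLpNorm_le_mul_add (hκ.aestronglyMeasurable τ) (mκg τ)
      (huτ.mono fun x hx => ?_)).trans ((small _ _ k3 k4).trans hε42)
    rw [hx, sub_zero, norm_mul]
    gcongr
    · exact hMφ x
    · exact le_add_of_nonneg_right (norm_nonneg _)
  · calc eLpNorm (fun x => gradient (fun x => φ x * κ x) x - S.indicator ξ x) 2 ν
        = eLpNorm ((fun x => φ x • gradient κ x + (κ x - 1) • gradient φ x) +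
            fun x => gradient φ x - ξ x) 2 ν := by
          refine eLpNorm_congr_ae (hξν.mono fun x hx => ?_)
          simp only [Pi.add_apply]
          rw [hx, hgrad]; module
      _ ≤ eLpNorm (fun x => φ x • gradient κ x + (κ x - 1) • gradient φ x) 2 ν +
          eLpNorm (fun x => gradient φ x - ξ x) 2 ν :=
          eLpNorm_add_le (((hφ.aestronglyMeasurable ν).smul (mκg ν)).add
            ((mκ1 ν).smul (hφ.aestronglyMeasurable_gradient ν)))
            ((hφ.aestronglyMeasurable_gradient ν).sub hξ.1) (by norm_num)
      _ ≤ ε / 2 / 2 + ε / 2 / 2 := by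
          refine add_le_add ?_ h2
          refine (eLpNorm_le_mul_add (mκ1 ν) (mκg ν)
            (ae_of_all _ fun x => ?_)).trans (small _ _ k1 k2)
          refine (norm_add_le _ _).trans ?_
          rw [norm_smul, norm_smul, mul_add, add_comm, mul_comm ‖κ x - 1‖]
          gcongr
          · exact hMg x
          · exact hMφ x
      _ = ε / 2 := ENNReal.add_halves _
  · refine (eLpNorm_le_mul_add (hκ.aestronglyMeasurable τ) (mκg τ)
      (hξτ.mono fun x hx => ?_)).trans ((small _ _ k3 k4).trans hε42)
    rw [hx, sub_zero, hgrad]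
    refine (norm_add_le _ _).trans ?_
    rw [norm_smul, norm_smul, mul_add, add_comm, mul_comm ‖κ x‖]
    gcongr
    · exact hMg x
    · exact hMφ x

/-! ### Mollification in `L²` -/

section Mollification

variable {E : Type*} [NormedAddCommGroup E] [NormedSpace ℝ E] [FiniteDimensional ℝ E]
  [MeasurableSpace E] [BorelSpace E] {m : Measure E} [m.IsAddHaarMeasure]

lemma exists_eLpNorm_translate_sub_le {h : E → ℝ} (hh : MemLp h 2 m) {ε : ℝ≥0∞} (hε : 0 < ε) :
    ∃ δ > 0, ∀ z : E, ‖z‖ ≤ δ → eLpNorm (fun y => h (y - z) - h y) 2 m ≤ ε := by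
  let g : C(E, C(E, E)) :=
    (ContinuousMap.mk (fun a : E × E => a.2 - a.1) (by fun_prop)).curry
  have hg : ∀ z, MeasurePreserving (g z) m m := fun z => measurePreserving_sub_right m z
  have hcont := Continuous.compMeasurePreservingLp (f := fun _ : E => hh.toLp h) continuous_const
    g.continuous hg (by norm_num)
  have h0 := (hcont.tendsto 0).eventually (Metric.eball_mem_nhds _ hε)
  obtain ⟨δ, hδ, hball⟩ := Metric.eventually_nhds_iff.1 h0
  refine ⟨δ / 2, half_pos hδ, fun z hz => ?_⟩
  have h1 := hball (y := z) (by rw [dist_zero_right]; linarith)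
  rw [Lp.edist_def] at h1
  refine le_trans (le_of_eq (eLpNorm_congr_ae ?_)) h1.le
  have h2 := Lp.coeFn_compMeasurePreserving (hh.toLp h) (hg z)
  have h3 := Lp.coeFn_compMeasurePreserving (hh.toLp h) (hg 0)
  have h4 := (hg z).quasiMeasurePreserving.ae_eq_comp hh.coeFn_toLp
  filter_upwards [h2, h3, h4, hh.coeFn_toLp] with y e2 e3 e4 e5
  have hz' : g z y = y - z := rfl
  have h0' : g 0 y = y := sub_zero y
  simp only [Function.comp_apply, hz', h0'] at e2 e3 e4
  simp only [Pi.sub_apply]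
  rw [e2, e3, e4, e5]

/-- Jensen's inequality for squares. -/
lemma lintegral_sq_le {Ω : Type*} [MeasurableSpace Ω] {P : Measure Ω} [IsProbabilityMeasure P]
    {f : Ω → ℝ≥0∞} (hf : AEMeasurable f P) : (∫⁻ z, f z ∂P) ^ 2 ≤ ∫⁻ z, f z ^ 2 ∂P := by
  have := eLpNorm_le_eLpNorm_of_exponent_le (μ := P) (p := 1) (q := 2) (f := f) (by norm_num)
    hf.aestronglyMeasurable
  rw [eLpNorm_one_eq_lintegral_enorm,
    eLpNorm_eq_lintegral_rpow_enorm_toReal (by norm_num) (by norm_num)] at this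
  simp only [enorm_eq_self, ENNReal.toReal_ofNat, ENNReal.rpow_ofNat] at this
  calc (∫⁻ z, f z ∂P) ^ 2 ≤ ((∫⁻ z, f z ^ 2 ∂P) ^ (1 / 2 : ℝ)) ^ 2 := by gcongr
    _ = ∫⁻ z, f z ^ 2 ∂P := by
      rw [← ENNReal.rpow_natCast, ← ENNReal.rpow_mul]; norm_num

/-- Averaging translates over small vectors changes an `L²` function little. The kernel need not be
centred at the origin. -/
lemma exists_eLpNorm_mollify_sub_le {h : E → ℝ} (hh : MemLp h 2 m) {ε : ℝ≥0∞} (hε : 0 < ε) :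
    ∃ δ > 0, ∀ ρ : E → ℝ, Continuous ρ → HasCompactSupport ρ → (∀ z, 0 ≤ ρ z) → ∫ z, ρ z ∂m = 1 →
      (∀ z, ρ z ≠ 0 → ‖z‖ ≤ δ) →
      eLpNorm (fun y => (∫ z, ρ z * h (y - z) ∂m) - h y) 2 m ≤ ε := by
  -- Tonelli's theorem below needs a jointly measurable integrand
  wlog hmeas : StronglyMeasurable h generalizing h
  · obtain ⟨δ, hδ, H⟩ := this (hh.ae_eq hh.1.ae_eq_mk) hh.1.stronglyMeasurable_mk
    refine ⟨δ, hδ, fun ρ h1 h2 h3 h4 h5 => le_trans (le_of_eq (eLpNorm_congr_ae ?_))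
      (H ρ h1 h2 h3 h4 h5)⟩
    filter_upwards [hh.1.ae_eq_mk] with y hy
    rw [hy]
    congr 1
    refine integral_congr_ae ?_
    filter_upwards [(Measure.measurePreserving_sub_left m y).quasiMeasurePreserving.ae_eq_comp
      hh.1.ae_eq_mk] with z hz
    simp only [Function.comp_apply] at hz
    rw [hz]
  obtain ⟨δ, hδ, H⟩ := exists_eLpNorm_translate_sub_le hh hε
  refine ⟨δ, hδ, fun ρ hρ hρc hρ0 hρ1 hρδ => ?_⟩
  have hρi : Integrable ρ m := hρ.integrable_of_hasCompactSupport hρc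
  set P : Measure E := m.withDensity fun z => ENNReal.ofReal (ρ z) with hP
  have hdm : Measurable fun z => ENNReal.ofReal (ρ z) := hρ.measurable.ennreal_ofReal
  have : IsProbabilityMeasure P := ⟨by
    rw [hP, withDensity_apply _ .univ, Measure.restrict_univ,
      ← ofReal_integral_eq_lintegral_ofReal hρi (ae_of_all _ hρ0), hρ1, ENNReal.ofReal_one]⟩
  have hint : ∀ y, Integrable (fun z => ρ z * h (y - z)) m := by
    intro y
    have hli : LocallyIntegrable h m := hh.locallyIntegrable (by norm_num)
    exact (hρc.convolutionExists_left (ContinuousLinearMap.mul ℝ ℝ) hρ hli y)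
  have hjm : Measurable fun a : E × E => ‖h (a.1 - a.2) - h a.1‖ₑ :=
    ((hmeas.measurable.comp (measurable_fst.sub measurable_snd)).sub
      (hmeas.measurable.comp measurable_fst)).enorm
  have hpt : ∀ y, ‖(∫ z, ρ z * h (y - z) ∂m) - h y‖ₑ ^ 2 ≤ ∫⁻ z, ‖h (y - z) - h y‖ₑ ^ 2 ∂P := by
    intro y
    refine le_trans ?_ (lintegral_sq_le (hjm.comp measurable_prodMk_left).aemeasurable)
    gcongr
    have e1 : (∫ z, ρ z * h (y - z) ∂m) - h y = ∫ z, ρ z * (h (y - z) - h y) ∂m := by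
      simp only [mul_sub]
      rw [integral_sub (hint y) (hρi.mul_const _), integral_mul_const, hρ1, one_mul]
    rw [e1]
    refine (enorm_integral_le_lintegral_enorm _).trans (le_of_eq ?_)
    have hsec : Measurable fun z => ‖h (y - z) - h y‖ₑ := hjm.comp measurable_prodMk_left
    rw [hP, lintegral_withDensity_eq_lintegral_mul _ hdm hsec]
    refine lintegral_congr fun z => ?_
    simp only [Pi.mul_apply, enorm_mul]
    rw [Real.enorm_of_nonneg (hρ0 z)]
  have hmain : ∫⁻ y, ‖(∫ z, ρ z * h (y - z) ∂m) - h y‖ₑ ^ 2 ∂m ≤ ε ^ 2 := by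
    refine (lintegral_mono hpt).trans ?_
    rw [lintegral_lintegral_swap (hjm.pow_const 2).aemeasurable]
    have hz : ∀ᵐ z ∂P, ∫⁻ y, ‖h (y - z) - h y‖ₑ ^ 2 ∂m ≤ ε ^ 2 := by
      rw [hP, ae_withDensity_iff hdm]
      refine ae_of_all _ fun z hz => ?_
      have hzρ : ρ z ≠ 0 := fun h0 => hz (by simp [h0])
      have := H z (hρδ z hzρ)
      rw [eLpNorm_eq_lintegral_rpow_enorm_toReal (by norm_num) (by norm_num)] at this
      simp only [ENNReal.toReal_ofNat, ENNReal.rpow_ofNat] at this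
      calc _ = ((∫⁻ y, ‖h (y - z) - h y‖ₑ ^ 2 ∂m) ^ (1 / 2 : ℝ)) ^ 2 := by
            rw [← ENNReal.rpow_natCast, ← ENNReal.rpow_mul]; norm_num
        _ ≤ ε ^ 2 := by gcongr
    calc _ ≤ ∫⁻ z, ε ^ 2 ∂P := lintegral_mono_ae hz
      _ = ε ^ 2 := by simp
  rw [eLpNorm_eq_lintegral_rpow_enorm_toReal (by norm_num) (by norm_num)]
  simp only [ENNReal.toReal_ofNat, ENNReal.rpow_ofNat]
  calc _ ≤ (ε ^ 2) ^ (1 / 2 : ℝ) := by gcongr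
    _ = ε := by rw [← ENNReal.rpow_natCast, ← ENNReal.rpow_mul]; norm_num

end Mollification

/-! ### Smooth approximation of Sobolev functions -/

lemma norm_le_sum_coord {d : ℕ} (v : EuclideanSpace ℝ (Fin d)) : ‖v‖ ≤ ∑ i, ‖v i‖ := by
  conv_lhs => rw [← (EuclideanSpace.basisFun (Fin d) ℝ).sum_repr v]
  refine (norm_sum_le _ _).trans (Finset.sum_le_sum fun i _ => ?_)
  simp [norm_smul]

/-- Differentiating a convolution with a kernel whose translate by `y` is supported in `D` moves the
derivative onto the weak gradient. -/
lemma fderiv_mollify {d : ℕ} {D : Set (EuclideanSpace ℝ (Fin d))} (hD : MeasurableSet D)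
    {g : EuclideanSpace ℝ (Fin d) → ℝ} {G : EuclideanSpace ℝ (Fin d) → EuclideanSpace ℝ (Fin d)}
    (hg : LocallyIntegrable (D.indicator g) volume)
    (hG : ∀ φ : EuclideanSpace ℝ (Fin d) → ℝ, ContDiff ℝ ∞ φ → HasCompactSupport φ →
      tsupport φ ⊆ D → ∀ i : Fin d,
        ∫ y in D, g y * fderiv ℝ φ y (EuclideanSpace.single i 1) = -∫ y in D, G y i * φ y)
    {ρ : EuclideanSpace ℝ (Fin d) → ℝ} (hρ : ContDiff ℝ ∞ ρ) (hρc : HasCompactSupport ρ)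
    {y : EuclideanSpace ℝ (Fin d)} (hy : tsupport (fun z => ρ (y - z)) ⊆ D) (i : Fin d) :
    fderiv ℝ (fun y => ∫ z, ρ z * D.indicator g (y - z)) y (EuclideanSpace.single i 1) =
      ∫ z, ρ z * D.indicator (fun x => G x i) (y - z) := by
  have h1 := hρc.hasFDerivAt_convolution_left (ContinuousLinearMap.mul ℝ ℝ) (μ := volume)
    (hρ.of_le (by simp)) hg y
  have e0 : (fun y => ∫ z, ρ z * D.indicator g (y - z)) =
    convolution ρ (D.indicator g) (ContinuousLinearMap.mul ℝ ℝ) volume := rfl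
  rw [e0, h1.fderiv]
  have hcsub : HasCompactSupport (fun z => ρ (y - z)) :=
    hρc.comp_homeomorph (Homeomorph.subLeft y)
  have hφ : ContDiff ℝ ∞ (fun z => ρ (y - z)) := hρ.comp (contDiff_const.sub contDiff_id)
  have hder : ∀ z, fderiv ℝ (fun z => ρ (y - z)) z (EuclideanSpace.single i 1) =
      -fderiv ℝ ρ (y - z) (EuclideanSpace.single i 1) := by
    intro z
    have hd : HasFDerivAt (fun z => ρ (y - z))
        ((fderiv ℝ ρ (y - z)).comp (-ContinuousLinearMap.id ℝ _)) z :=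
      ((hρ.differentiable (by simp)) (y - z)).hasFDerivAt.comp z
        ((hasFDerivAt_id z).const_sub y)
    rw [hd.fderiv]; simp
  have hweak := hG _ hφ hcsub hy i
  simp only [hder] at hweak
  have hci : Integrable (fun t => (ContinuousLinearMap.precompL (EuclideanSpace ℝ (Fin d))
      (ContinuousLinearMap.mul ℝ ℝ) (fderiv ℝ ρ t)) (D.indicator g (y - t))) volume :=
    (hρc.fderiv ℝ).convolutionExists_left _ (hρ.continuous_fderiv (by simp)) hg y
  rw [convolution_def, ContinuousLinearMap.integral_apply hci]
  have e1 : ∀ t, ((ContinuousLinearMap.precompL (EuclideanSpace ℝ (Fin d))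
      (ContinuousLinearMap.mul ℝ ℝ) (fderiv ℝ ρ t)) (D.indicator g (y - t)))
        (EuclideanSpace.single i 1) =
      fderiv ℝ ρ t (EuclideanSpace.single i 1) * D.indicator g (y - t) := fun t => by
    simp [ContinuousLinearMap.precompL_apply]
  simp only [e1]
  rw [← integral_sub_left_eq_self (fun t => fderiv ℝ ρ t (EuclideanSpace.single i 1) *
      D.indicator g (y - t)) volume y,
    ← integral_sub_left_eq_self (fun t => ρ t * D.indicator (fun x => G x i) (y - t)) volume y]
  simp only [sub_sub_cancel]
  have e2 : ∀ z, fderiv ℝ ρ (y - z) (EuclideanSpace.single i 1) * D.indicator g z =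
      D.indicator (fun z => -(g z * -fderiv ℝ ρ (y - z) (EuclideanSpace.single i 1))) z := fun z => by
    by_cases hz : z ∈ D <;> simp [hz, mul_comm]
  have e3 : ∀ z, ρ (y - z) * D.indicator (fun x => G x i) z =
      D.indicator (fun z => G z i * ρ (y - z)) z := fun z => by
    by_cases hz : z ∈ D <;> simp [hz, mul_comm]
  simp only [e2, e3]
  rw [integral_indicator hD, integral_indicator hD, integral_neg, hweak, neg_neg]

/-- An `H¹` function on `D` is approximated in `H¹` by smooth functions on a subset `K` that can be
pushed into `D` in a fixed direction `e`, such as a half-ball touching the boundary of a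
half-space. -/
lemma MemH1Open.exists_smooth_approx {d : ℕ} {D K : Set (EuclideanSpace ℝ (Fin d))}
    (hD : MeasurableSet D) (hK : MeasurableSet K) (hKD : K ⊆ D) {g : EuclideanSpace ℝ (Fin d) → ℝ}
    (hg : MemH1Open D g) {e : EuclideanSpace ℝ (Fin d)} (he : ‖e‖ ≤ 1) {t₀ : ℝ} (ht₀ : 0 < t₀)
    (hpush : ∀ y ∈ K, ∀ t, 0 < t → t < t₀ → Metric.closedBall (y + (2 * t) • e) t ⊆ D) :
    MemLp g 2 (volume.restrict K) ∧
    ∃ G : EuclideanSpace ℝ (Fin d) → EuclideanSpace ℝ (Fin d), MemLp G 2 (volume.restrict K) ∧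
      ∀ ε : ℝ≥0∞, 0 < ε → ∃ f : EuclideanSpace ℝ (Fin d) → ℝ, ContDiff ℝ ∞ f ∧
        eLpNorm (fun y => f y - g y) 2 (volume.restrict K) ≤ ε ∧
        eLpNorm (fun y => gradient f y - G y) 2 (volume.restrict K) ≤ ε := by
  obtain ⟨hg2, G, hG2, hG⟩ := hg
  have hres : (volume : Measure (EuclideanSpace ℝ (Fin d))).restrict K ≤ volume.restrict D :=
    Measure.restrict_mono hKD le_rfl
  refine ⟨hg2.mono_measure hres, G, hG2.mono_measure hres, fun ε hε => ?_⟩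
  have hgD : MemLp (D.indicator g) 2 volume := (memLp_indicator_iff_restrict hD).2 hg2
  have hGD : ∀ i, MemLp (D.indicator fun x => G x i) 2 volume := fun i =>
    (memLp_indicator_iff_restrict hD).2
      (hG2.of_le ((EuclideanSpace.proj (𝕜 := ℝ) i).continuous.comp_aestronglyMeasurable hG2.1)
        (ae_of_all _ fun x => PiLp.norm_apply_le (G x) i))
  obtain ⟨ε', hε', hε'ε⟩ := exists_pos_mul_le (C := (d : ℝ≥0∞)) (by simp) hε
  obtain ⟨δ₀, hδ₀, H₀⟩ := exists_eLpNorm_mollify_sub_le hgD hε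
  choose δ hδ H using fun i => exists_eLpNorm_mollify_sub_le (hGD i) hε'
  obtain ⟨t, ht, htt₀, htδ₀, htδ⟩ : ∃ t > 0, t < t₀ ∧ 3 * t ≤ δ₀ ∧ ∀ i, 3 * t ≤ δ i := by
    have hlim : Tendsto (fun t : ℝ => 3 * t) (𝓝[>] 0) (𝓝 0) := by
      have : Tendsto (fun t : ℝ => 3 * t) (𝓝 0) (𝓝 (3 * 0)) := tendsto_id.const_mul 3
      rw [mul_zero] at this
      exact this.mono_left nhdsWithin_le_nhds
    have hpos : ∀ᶠ t : ℝ in 𝓝[>] 0, 0 < t := self_mem_nhdsWithin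
    have := (hpos.and
      ((hlim.eventually (Iio_mem_nhds ht₀)).and ((hlim.eventually (Iio_mem_nhds hδ₀)).and
        (eventually_all.2 fun i => hlim.eventually (Iio_mem_nhds (hδ i)))))).exists
    obtain ⟨t, h1, h2, h3, h4⟩ := this
    have h2 : 3 * t < t₀ := h2
    exact ⟨t, h1, by linarith, h3.le, fun i => (h4 i).le⟩
  -- with this kernel only the values of `g` in the ball of radius `t` around `y + 2te` enter at `y`
  let b : ContDiffBump (-((2 * t) • e)) := ⟨t / 2, t, by positivity, by linarith⟩
  set ρ := b.normed volume with hρ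
  have hρs : ∀ z, ρ z ≠ 0 → ‖z‖ ≤ 3 * t := fun z hz => by
    have hz : z ∈ Metric.ball (-((2 * t) • e)) t := by
      have : z ∈ Function.support (b.normed volume) := hz
      rwa [b.support_normed_eq] at this
    rw [mem_ball_iff_norm] at hz
    have h2 : ‖-((2 * t) • e)‖ ≤ 2 * t := by
      rw [norm_neg, norm_smul, Real.norm_of_nonneg (by positivity)]
      nlinarith
    calc ‖z‖ = ‖(z - -((2 * t) • e)) + -((2 * t) • e)‖ := by rw [sub_add_cancel]
      _ ≤ t + 2 * t := (norm_add_le _ _).trans (add_le_add hz.le h2)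
      _ = 3 * t := by ring
  have hρC : ContDiff ℝ ∞ ρ := b.contDiff_normed (n := ⊤)
  have hρc : HasCompactSupport ρ := b.hasCompactSupport_normed
  have hli : LocallyIntegrable (D.indicator g) volume := hgD.locallyIntegrable (by norm_num)
  have hts : ∀ y ∈ K, tsupport (fun z => ρ (y - z)) ⊆ D := by
    intro y hy
    refine Set.Subset.trans (closure_minimal (fun z hz => ?_) Metric.isClosed_closedBall)
      (hpush y hy t ht htt₀)
    have hz : y - z ∈ Metric.ball (-((2 * t) • e)) t := by
      have : y - z ∈ Function.support (b.normed volume) := hz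
      rwa [b.support_normed_eq] at this
    rw [mem_ball_iff_norm] at hz
    have e1 : z - (y + (2 * t) • e) = -(y - z - -((2 * t) • e)) := by
      generalize (2 * t) • e = c
      abel
    rw [mem_closedBall_iff_norm, e1, norm_neg]
    exact hz.le
  have H₀' := H₀ ρ hρC.continuous hρc b.nonneg_normed b.integral_normed
    fun z hz => (hρs z hz).trans htδ₀
  have H' := fun i => H i ρ hρC.continuous hρc b.nonneg_normed b.integral_normed
    fun z hz => (hρs z hz).trans (htδ i)
  have hf : ContDiff ℝ ∞ fun y => ∫ z, ρ z * D.indicator g (y - z) :=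
    hρc.contDiff_convolution_left (ContinuousLinearMap.mul ℝ ℝ) (n := ⊤) hρC hli
  refine ⟨fun y => ∫ z, ρ z * D.indicator g (y - z), hf, ?_, ?_⟩
  · refine le_trans (le_of_eq ?_) ((eLpNorm_mono_measure _ (Measure.restrict_le_self (s := K))).trans H₀')
    refine eLpNorm_congr_ae ((ae_restrict_iff' hK).2 (ae_of_all _ fun y hy => ?_))
    simp only [Set.indicator_of_mem (hKD hy)]
  · set f := fun y => ∫ z, ρ z * D.indicator g (y - z) with hfdef
    have hgc : Continuous (gradient f) :=
      (LinearIsometryEquiv.continuous _).comp (hf.continuous_fderiv (by simp))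
    have hsm : ∀ i, AEStronglyMeasurable (fun y => ‖gradient f y i - G y i‖) (volume.restrict K) :=
      fun i => ((EuclideanSpace.proj (𝕜 := ℝ) i).continuous.comp_aestronglyMeasurable
        (hgc.aestronglyMeasurable.sub (hG2.mono_measure hres).1)).norm
    calc eLpNorm (fun y => gradient f y - G y) 2 (volume.restrict K)
        ≤ eLpNorm (∑ i : Fin d, fun y => ‖gradient f y i - G y i‖) 2 (volume.restrict K) := by
          refine eLpNorm_mono_real fun y => ?_
          simpa using norm_le_sum_coord (gradient f y - G y)
      _ ≤ ∑ i : Fin d, eLpNorm (fun y => ‖gradient f y i - G y i‖) 2 (volume.restrict K) :=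
          eLpNorm_sum_le (fun i _ => hsm i) (by norm_num)
      _ ≤ ∑ i : Fin d, ε' := by
          refine Finset.sum_le_sum fun i _ => ?_
          rw [eLpNorm_norm]
          refine le_trans (le_of_eq ?_) ((eLpNorm_mono_measure _ (Measure.restrict_le_self (s := K))).trans
            (H' i))
          refine eLpNorm_congr_ae ((ae_restrict_iff' hK).2 (ae_of_all _ fun y hy => ?_))
          have e1 : gradient f y i = fderiv ℝ f y (EuclideanSpace.single i 1) := by
            have h1 := EuclideanSpace.inner_single_right (𝕜 := ℝ) i 1 (gradient f y)
            have h2 : inner ℝ (gradient f y) (EuclideanSpace.single i (1 : ℝ)) =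
              fderiv ℝ f y (EuclideanSpace.single i 1) := by
              rw [gradient, InnerProductSpace.toDual_symm_apply]
            rw [← h2, h1]; simp
          have e2 := fderiv_mollify hD hli hG hρC hρc (hts y hy) i
          simp only [e1]
          rw [hfdef, e2, Set.indicator_of_mem (hKD hy)]
      _ = d * ε' := by simp
      _ ≤ ε := hε'ε

/-! ### Slice charts and surface measure -/

/-- The projection `ℝ³ → ℝᵈ` onto the first `d` coordinates. -/
noncomputable def unpad (d : ℕ) (hd : d ≤ 3) : E3 →L[ℝ] EuclideanSpace ℝ (Fin d) :=
  (EuclideanSpace.equiv (Fin d) ℝ).symm.toContinuousLinearMap.comp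
    (ContinuousLinearMap.pi fun j => EuclideanSpace.proj (Fin.castLE hd j))

@[simp] lemma unpad_apply {d : ℕ} (hd : d ≤ 3) (x : E3) (j : Fin d) :
    unpad d hd x j = x (Fin.castLE hd j) := rfl

lemma pad_unpad {d : ℕ} (hd : d ≤ 3) {x : E3} (hx : ∀ j : Fin 3, d ≤ (j : ℕ) → x j = 0) :
    pad d (unpad d hd x) = x := by
  ext j
  by_cases h : (j : ℕ) < d
  · simp [pad, h]
  · simp [pad, h, hx j (not_lt.1 h)]

lemma pad_zero_eq {d : ℕ} (hd0 : 0 < d) (y : EuclideanSpace ℝ (Fin d)) :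
    pad d y 0 = y ⟨0, hd0⟩ := by
  simp [pad, hd0]

lemma isometry_pad {d : ℕ} (hd : d = 1 ∨ d = 2) : Isometry (pad d) := by
  refine Isometry.of_dist_eq fun x y => ?_
  rcases hd with rfl | rfl <;> simp [EuclideanSpace.dist_eq, pad, Fin.sum_univ_succ]

lemma lipschitzWith_unpad {d : ℕ} (hd : d = 1 ∨ d = 2) (hd3 : d ≤ 3) :
    LipschitzWith 1 (unpad d hd3) := by
  refine LipschitzWith.of_dist_le_mul fun x y => ?_
  rcases hd with rfl | rfl
  all_goals
    simp only [EuclideanSpace.dist_eq, NNReal.coe_one, one_mul]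
    refine Real.sqrt_le_sqrt ?_
    simp only [Fin.sum_univ_succ, unpad_apply]
    simp
    try positivity

lemma euclideanHausdorffMeasure_image_le {d : ℕ} {X Y : Type*} [MetricSpace X] [MeasurableSpace X]
    [BorelSpace X] [MetricSpace Y] [MeasurableSpace Y] [BorelSpace Y] {f : X → Y} {s : Set X}
    {L : ℝ≥0} (h : LipschitzOnWith L f s) :
    Measure.euclideanHausdorffMeasure d (f '' s) ≤
      (L : ℝ≥0∞) ^ d * Measure.euclideanHausdorffMeasure d s := by
  simp only [Measure.euclideanHausdorffMeasure_def, Measure.smul_apply, ENNReal.smul_def, smul_eq_mul]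
  rw [mul_left_comm]
  gcongr
  simpa using h.hausdorffMeasure_image_le (d := d) (by positivity)

/-- The first `d` chart coordinates `x ↦ (Φ₁ x, …, Φ_d x)`; on `S` they invert `Φ.symm ∘ pad d`. -/
noncomputable def chartCoord (d : ℕ) (hd : d ≤ 3) (Φ : OpenPartialHomeomorph E3 E3) (x : E3) :
    EuclideanSpace ℝ (Fin d) :=
  unpad d hd (Φ x)

/-- The coordinates of the interior points of the submanifold that lie in a ball of the chart. -/
def halfBall (d : ℕ) (q : E3) (s : ℝ) : Set (EuclideanSpace ℝ (Fin d)) :=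
  {y | pad d y ∈ Metric.ball q s ∧ 0 < pad d y 0}

lemma measurableSet_halfBall {d : ℕ} (hd : d = 1 ∨ d = 2) (q : E3) (s : ℝ) :
    MeasurableSet (halfBall d q s) := by
  have hc := (isometry_pad hd).continuous
  exact ((Metric.isOpen_ball.preimage hc).inter (isOpen_lt continuous_const
    ((EuclideanSpace.proj (𝕜 := ℝ) (0 : Fin 3)).continuous.comp hc))).measurableSet

lemma volume_hyperplane {d : ℕ} (hd0 : 0 < d) :
    volume {y : EuclideanSpace ℝ (Fin d) | y ⟨0, hd0⟩ = 0} = 0 := by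
  let ℓ := (EuclideanSpace.proj (𝕜 := ℝ) (⟨0, hd0⟩ : Fin d) : EuclideanSpace ℝ (Fin d) →L[ℝ] ℝ)
  have h := Measure.addHaar_submodule (volume : Measure (EuclideanSpace ℝ (Fin d)))
    (LinearMap.ker (ℓ : EuclideanSpace ℝ (Fin d) →ₗ[ℝ] ℝ)) (by
      intro h
      have : EuclideanSpace.single (⟨0, hd0⟩ : Fin d) (1 : ℝ) ∈
        LinearMap.ker (ℓ : EuclideanSpace ℝ (Fin d) →ₗ[ℝ] ℝ) := by rw [h]; trivial
      simp [ℓ] at this)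
  exact h

/-- Quantitative data of a slice chart `Φ` near `p`, on a ball of radius `r` around `p`. -/
structure ChartBall (d : ℕ) (S : Set E3) (Φ : OpenPartialHomeomorph E3 E3) (p : E3)
    (r s : ℝ) (L : ℝ≥0) : Prop where
  r_pos : 0 < r
  s_pos : 0 < s
  slice : IsSliceChart d S Φ
  ball_subset : Metric.closedBall p (2 * r) ⊆ Φ.source
  lipschitz : LipschitzOnWith L Φ (Metric.ball p (2 * r))
  ball_subset_target : Metric.ball (Φ p) (2 * s) ⊆ Φ.target
  mapsTo : Set.MapsTo Φ (Metric.ball p r) (Metric.ball (Φ p) s)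
  lipschitz_symm : LipschitzOnWith L Φ.symm (Metric.ball (Φ p) s)

lemma IsSliceChart.exists_chartBall {d : ℕ} {S : Set E3} {Φ : OpenPartialHomeomorph E3 E3}
    (h : IsSliceChart d S Φ) {p : E3} (hp : p ∈ Φ.source) :
    ∃ s L, ∃ r₀ > 0, ∀ r, 0 < r → r ≤ r₀ → ChartBall d S Φ p r s L := by
  have hΦ : ContDiffAt ℝ 1 Φ p :=
    (h.smooth.contDiffAt (Φ.open_source.mem_nhds hp)).of_le (by simp)
  have hΨ : ContDiffAt ℝ 1 Φ.symm (Φ p) :=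
    (h.smooth_symm.contDiffAt (Φ.open_target.mem_nhds (Φ.map_source hp))).of_le (by simp)
  obtain ⟨L₁, U, hU, hL₁⟩ := hΦ.exists_lipschitzOnWith
  obtain ⟨L₂, V, hV, hL₂⟩ := hΨ.exists_lipschitzOnWith
  obtain ⟨s, hs, hsV⟩ := Metric.nhds_basis_ball.mem_iff.1
    (inter_mem hV (Φ.open_target.mem_nhds (Φ.map_source hp)))
  have hpre : Φ ⁻¹' Metric.ball (Φ p) (s / 2) ∈ 𝓝 p :=
    (Φ.continuousAt hp).preimage_mem_nhds (Metric.ball_mem_nhds _ (half_pos hs))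
  obtain ⟨r, hr, hrU⟩ := Metric.nhds_basis_closedBall.mem_iff.1
    (inter_mem (inter_mem hU hpre) (Φ.open_source.mem_nhds hp))
  refine ⟨s / 2, max L₁ L₂, r / 2, half_pos hr, fun r' hr' hr'r => ?_⟩
  have hsub : Metric.closedBall p (2 * r') ⊆ Metric.closedBall p r :=
    Metric.closedBall_subset_closedBall (by linarith)
  refine ⟨hr', half_pos hs, h, fun x hx => (hrU (hsub hx)).2, ?_, ?_, ?_, ?_⟩
  · exact (hL₁.mono fun x hx => (hrU (hsub (Metric.ball_subset_closedBall hx))).1.1).weaken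
      (le_max_left _ _)
  · rw [mul_div_cancel₀ _ (two_ne_zero' ℝ)]
    exact fun x hx => (hsV hx).2
  · exact fun x hx => (hrU (hsub (Metric.closedBall_subset_closedBall (by linarith)
      (Metric.ball_subset_closedBall hx)))).1.2
  · exact (hL₂.mono fun x hx => (hsV (Metric.ball_subset_ball (by linarith) hx)).1).weaken
      (le_max_right _ _)

namespace ChartBall

variable {d : ℕ} {S : Set E3} {Φ : OpenPartialHomeomorph E3 E3} {p : E3} {r s : ℝ} {L : ℝ≥0}

lemma ball_subset_source (h : ChartBall d S Φ p r s L) : Metric.ball p r ⊆ Φ.source :=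
  fun _ hx => h.ball_subset (Metric.closedBall_subset_closedBall (by linarith [h.r_pos])
    (Metric.ball_subset_closedBall hx))

lemma ball_subset_ball_two (h : ChartBall d S Φ p r s L) :
    Metric.ball p r ⊆ Metric.ball p (2 * r) :=
  Metric.ball_subset_ball (by linarith [h.r_pos])

lemma contDiffOn_chartCoord (h : ChartBall d S Φ p r s L) (hd : d ≤ 3) :
    ContDiffOn ℝ ∞ (chartCoord d hd Φ) Φ.source :=
  (unpad d hd).contDiff.comp_contDiffOn h.slice.smooth

lemma lipschitzOnWith_chartCoord (h : ChartBall d S Φ p r s L) (hd : d = 1 ∨ d = 2) (hd3 : d ≤ 3) :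
    LipschitzOnWith L (chartCoord d hd3 Φ) (Metric.ball p (2 * r)) := by
  have := (lipschitzWith_unpad hd hd3).comp_lipschitzOnWith h.lipschitz
  rwa [one_mul] at this

lemma pad_chartCoord (h : ChartBall d S Φ p r s L) (hd : d ≤ 3) {x : E3} (hx : x ∈ Metric.ball p r)
    (hxS : x ∈ S) : pad d (chartCoord d hd Φ x) = Φ x :=
  pad_unpad hd ((h.slice.slice x (h.ball_subset_source hx)).1 hxS).2

lemma aemeasurable_chartCoord (h : ChartBall d S Φ p r s L) (hd : d ≤ 3) (ν : Measure E3) :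
    AEMeasurable (chartCoord d hd Φ) (ν.restrict (Metric.ball p r)) :=
  ((h.contDiffOn_chartCoord hd).continuousOn.mono h.ball_subset_source).aemeasurable
    measurableSet_ball

/-- In a chart, surface measure is dominated by Lebesgue measure on the half-ball. -/
lemma map_surfaceMeasure_le (h : ChartBall d S Φ p r s L) (hd : d = 1 ∨ d = 2) (hd3 : d ≤ 3)
    (hS : MeasurableSet S) :
    ((surfaceMeasure d S).restrict (Metric.ball p r)).map (chartCoord d hd3 Φ) ≤
      (L : ℝ≥0∞) ^ d • volume.restrict (halfBall d (Φ p) s) := by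
  have hd0 : 0 < d := by omega
  refine Measure.le_iff.2 fun A hA => ?_
  rw [Measure.map_apply_of_aemeasurable (h.aemeasurable_chartCoord hd3 _) hA, surfaceMeasure,
    Measure.restrict_restrict measurableSet_ball,
    Measure.restrict_apply' (measurableSet_ball.inter hS)]
  set B : Set (EuclideanSpace ℝ (Fin d)) :=
    A ∩ {y | pad d y ∈ Metric.ball (Φ p) s ∧ 0 ≤ pad d y 0} with hB
  have hsub : chartCoord d hd3 Φ ⁻¹' A ∩ (Metric.ball p r ∩ S) ⊆ (Φ.symm ∘ pad d) '' B := by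
    rintro x ⟨hxA, hxb, hxS⟩
    have hpad := h.pad_chartCoord hd3 hxb hxS
    refine ⟨chartCoord d hd3 Φ x, ⟨hxA, ?_, ?_⟩, ?_⟩
    · rw [hpad]; exact h.mapsTo hxb
    · rw [hpad]; exact ((h.slice.slice x (h.ball_subset_source hxb)).1 hxS).1
    · rw [Function.comp_apply, hpad, Φ.left_inv (h.ball_subset_source hxb)]
  have hlip : LipschitzOnWith L (Φ.symm ∘ pad d) B := by
    have := h.lipschitz_symm.comp ((isometry_pad hd).lipschitz.lipschitzOnWith (s := B))
      fun y hy => hy.2.1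
    simpa using this
  refine (measure_mono hsub).trans ((euclideanHausdorffMeasure_image_le hlip).trans ?_)
  rw [EuclideanSpace.euclideanHausdorffMeasure_eq_volume, Measure.smul_apply, smul_eq_mul,
    Measure.restrict_apply hA]
  refine mul_le_mul' le_rfl ?_
  refine (measure_mono (μ := volume) (t := (A ∩ halfBall d (Φ p) s) ∪
    {y : EuclideanSpace ℝ (Fin d) | y ⟨0, hd0⟩ = 0}) ?_).trans ((measure_union_le _ _).trans ?_)
  · rintro y ⟨hyA, hyb, hy0⟩
    rcases hy0.eq_or_lt with h0 | h0
    · right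
      have := pad_zero_eq hd0 y
      show y ⟨0, hd0⟩ = 0
      rw [← this, ← h0]
    · exact Or.inl ⟨hyA, hyb, h0⟩
  · rw [volume_hyperplane, add_zero]

end ChartBall

/-! ### Approximation on a component -/

lemma IsTest.mul_contDiffOn {χ F : E3 → ℝ} {U : Set E3} (hχ : IsTest χ) (hU : IsOpen U)
    (hχU : tsupport χ ⊆ U) (hF : ContDiffOn ℝ ∞ F U) : IsTest (fun x => χ x * F x) := by
  refine ⟨contDiff_iff_contDiffAt.2 fun x => ?_, hχ.2.mul_right⟩
  by_cases hx : x ∈ U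
  · exact hχ.1.contDiffAt.mul (hF.contDiffAt (hU.mem_nhds hx))
  · have h0 : (fun x => χ x * F x) =ᶠ[𝓝 x] fun _ => 0 := by
      filter_upwards [(isClosed_tsupport χ).isOpen_compl.mem_nhds fun h => hx (hχU h)] with y hy
      rw [image_eq_zero_of_notMem_tsupport hy, zero_mul]
    exact contDiffAt_const.congr_of_eventuallyEq h0

/-- A function that is smooth near a closed ball agrees with a test function on the smaller ball. -/
lemma exists_isTest_eqOn_ball {F : E3 → ℝ} {U : Set E3} (hU : IsOpen U) {p : E3} {r : ℝ}
    (hr : 0 < r) (hb : Metric.closedBall p (2 * r) ⊆ U) (hF : ContDiffOn ℝ ∞ F U) :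
    ∃ φ, IsTest φ ∧ ∀ x ∈ Metric.ball p r, φ x = F x ∧ gradient φ x = gradient F x := by
  let b : ContDiffBump p := ⟨r, 2 * r, hr, by linarith⟩
  have hb1 : ∀ x ∈ Metric.ball p r, b x * F x = F x := fun x hx => by
    rw [b.one_of_mem_closedBall (Metric.ball_subset_closedBall hx), one_mul]
  refine ⟨fun x => b x * F x, IsTest.mul_contDiffOn ⟨b.contDiff, b.hasCompactSupport⟩ hU
    (by rwa [b.tsupport_eq]) hF, fun x hx => ⟨hb1 x hx, ?_⟩⟩
  rw [gradient_eq_toDual_symm, gradient_eq_toDual_symm, Filter.EventuallyEq.fderiv_eq]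
  filter_upwards [Metric.isOpen_ball.mem_nhds hx] with y hy using hb1 y hy

lemma gradient_comp {d : ℕ} {f : EuclideanSpace ℝ (Fin d) → ℝ} {π : E3 → EuclideanSpace ℝ (Fin d)}
    {x : E3} (hf : DifferentiableAt ℝ f (π x)) (hπ : DifferentiableAt ℝ π x) :
    gradient (fun x => f (π x)) x =
      ContinuousLinearMap.adjoint (fderiv ℝ π x) (gradient f (π x)) := by
  refine ext_inner_right ℝ fun v => ?_
  rw [ContinuousLinearMap.adjoint_inner_left, gradient, gradient,
    InnerProductSpace.toDual_symm_apply, InnerProductSpace.toDual_symm_apply,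
    show (fun x => f (π x)) = f ∘ π from rfl, fderiv_comp x hf hπ]
  rfl

lemma aestronglyMeasurable_clm_apply {F G : Type*} [NormedAddCommGroup F] [NormedSpace ℝ F]
    [NormedAddCommGroup G] [NormedSpace ℝ G] {ν : Measure E3} {A : E3 → F →L[ℝ] G} {v : E3 → F}
    (hA : AEStronglyMeasurable A ν) (hv : AEStronglyMeasurable v ν) :
    AEStronglyMeasurable (fun x => A x (v x)) ν :=
  (isBoundedBilinearMap_apply (𝕜 := ℝ) (E := F) (F := G)).continuous.comp_aestronglyMeasurable
    (hA.prodMk hv)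

lemma measurableSet_chartDomain {d : ℕ} (hd : d = 1 ∨ d = 2) (Φ : OpenPartialHomeomorph E3 E3) :
    MeasurableSet (chartDomain d Φ) := by
  have hc := (isometry_pad hd).continuous
  exact ((Φ.open_target.preimage hc).inter (isOpen_lt continuous_const
    ((EuclideanSpace.proj (𝕜 := ℝ) (0 : Fin 3)).continuous.comp hc))).measurableSet

namespace ChartBall

variable {d : ℕ} {S : Set E3} {Φ : OpenPartialHomeomorph E3 E3} {p : E3} {r s : ℝ} {L : ℝ≥0}

lemma eLpNorm_comp_chartCoord_le (h : ChartBall d S Φ p r s L) (hd : d = 1 ∨ d = 2) (hd3 : d ≤ 3)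
    (hS : MeasurableSet S) {F : Type*} [NormedAddCommGroup F] {f : EuclideanSpace ℝ (Fin d) → F}
    (hf : AEStronglyMeasurable f (volume.restrict (halfBall d (Φ p) s))) :
    eLpNorm (fun x => f (chartCoord d hd3 Φ x)) 2
        ((surfaceMeasure d S).restrict (Metric.ball p r)) ≤
      ((L : ℝ≥0∞) ^ d) ^ (1 / (2 : ℝ≥0∞)).toReal *
        eLpNorm f 2 (volume.restrict (halfBall d (Φ p) s)) := by
  have hle := h.map_surfaceMeasure_le hd hd3 hS
  rw [show (fun x => f (chartCoord d hd3 Φ x)) = f ∘ chartCoord d hd3 Φ from rfl,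
    ← eLpNorm_map_measure (hf.mono_ac ((Measure.absolutelyContinuous_of_le hle).trans
      Measure.smul_absolutelyContinuous)) (h.aemeasurable_chartCoord hd3 _)]
  refine (eLpNorm_mono_measure _ hle).trans (le_of_eq ?_)
  rw [eLpNorm_smul_measure_of_ne_top (by simp), smul_eq_mul]

lemma memLp_comp_chartCoord (h : ChartBall d S Φ p r s L) (hd : d = 1 ∨ d = 2) (hd3 : d ≤ 3)
    (hS : MeasurableSet S) {F : Type*} [NormedAddCommGroup F] {f : EuclideanSpace ℝ (Fin d) → F}
    (hf : MemLp f 2 (volume.restrict (halfBall d (Φ p) s))) :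
    MemLp (fun x => f (chartCoord d hd3 Φ x)) 2
      ((surfaceMeasure d S).restrict (Metric.ball p r)) := by
  have hle := h.map_surfaceMeasure_le hd hd3 hS
  exact MemLp.comp_of_map (hf.of_measure_le_smul (by finiteness) hle)
    (h.aemeasurable_chartCoord hd3 _)

lemma halfBall_subset (h : ChartBall d S Φ p r s L) : halfBall d (Φ p) s ⊆ chartDomain d Φ :=
  fun _ hy => ⟨h.ball_subset_target (Metric.ball_subset_ball (by linarith [h.s_pos]) hy.1), hy.2⟩

/-- Points of the half-ball are pushed into the chart domain along the inner normal. -/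
lemma closedBall_subset_chartDomain (h : ChartBall d S Φ p r s L) (hd : d = 1 ∨ d = 2)
    (hd0 : 0 < d) : ∀ y ∈ halfBall d (Φ p) s, ∀ t, 0 < t → t < s / 3 →
      Metric.closedBall (y + (2 * t) • EuclideanSpace.single ⟨0, hd0⟩ (1 : ℝ)) t ⊆
        chartDomain d Φ := by
  intro y hy t ht hts z hz
  set e : EuclideanSpace ℝ (Fin d) := EuclideanSpace.single ⟨0, hd0⟩ 1 with he'
  have he : ‖e‖ = 1 := by simp [e]
  rw [mem_closedBall_iff_norm] at hz
  constructor
  · refine h.ball_subset_target ?_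
    have h1 : dist (pad d z) (pad d y) ≤ 3 * t := by
      rw [(isometry_pad hd).dist_eq, dist_eq_norm]
      calc ‖z - y‖ = ‖(z - (y + (2 * t) • e)) + (2 * t) • e‖ := by congr 1; abel
        _ ≤ t + 2 * t := (norm_add_le _ _).trans (add_le_add hz (by
            rw [norm_smul, he, Real.norm_of_nonneg (by positivity), mul_one]))
        _ = 3 * t := by ring
    have h2 : dist (pad d y) (Φ p) < s := hy.1
    rw [Metric.mem_ball]
    linarith [dist_triangle (pad d z) (pad d y) (Φ p)]
  · have h1 := (PiLp.norm_apply_le (z - (y + (2 * t) • e)) ⟨0, hd0⟩).trans hz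
    have h2 := hy.2
    rw [pad_zero_eq hd0] at h2 ⊢
    simp only [PiLp.sub_apply, PiLp.add_apply, PiLp.smul_apply, smul_eq_mul, e,
      PiLp.single_apply, if_true, mul_one, Real.norm_eq_abs, abs_le] at h1
    linarith [h1.1]

/-- The chart coordinates pull smooth approximations of `w` in the half-ball back to test functions
in `ℝ³`, constant in the transverse chart directions. -/
lemma ambientH1 (h : ChartBall d S Φ p r s L) (hd : d = 1 ∨ d = 2) (hS : MeasurableSet S)
    {w : E3 → ℝ} (hw : MemLp w 2 (surfaceMeasure d S))
    (hH1 : MemH1Open (chartDomain d Φ) fun y => w (Φ.symm (pad d y))) :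
    AmbientH1 ((surfaceMeasure d S).restrict (Metric.ball p r)) w := by
  have hd0 : 0 < d := by omega
  have hd3 : d ≤ 3 := by omega
  set ν := (surfaceMeasure d S).restrict (Metric.ball p r) with hν
  set π := chartCoord d hd3 Φ with hπ
  have hD := measurableSet_chartDomain hd Φ
  have hK := measurableSet_halfBall hd (Φ p) s
  have he : ‖(EuclideanSpace.single ⟨0, hd0⟩ 1 : EuclideanSpace ℝ (Fin d))‖ = 1 := by simp
  obtain ⟨hg2, G, hG, happ⟩ := hH1.exists_smooth_approx hD hK h.halfBall_subset he.le
    (by linarith [h.s_pos] : 0 < s / 3) (h.closedBall_subset_chartDomain hd hd0)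
  have hπd : ∀ x ∈ Metric.ball p r, DifferentiableAt ℝ π x := fun x hx =>
    ((h.contDiffOn_chartCoord hd3).contDiffAt
      (Φ.open_source.mem_nhds (h.ball_subset_source hx))).differentiableAt (by simp)
  have hπL : ∀ x ∈ Metric.ball p r, ‖ContinuousLinearMap.adjoint (fderiv ℝ π x)‖ ≤ L := by
    intro x hx
    rw [LinearIsometryEquiv.norm_map]
    exact norm_fderiv_le_of_lipschitzOn ℝ
      (Metric.isOpen_ball.mem_nhds (h.ball_subset_ball_two hx)) (h.lipschitzOnWith_chartCoord hd hd3)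
  have hmem : ∀ᵐ x ∂ν, x ∈ Metric.ball p r := ae_restrict_mem measurableSet_ball
  have hmemS : ∀ᵐ x ∂ν, x ∈ S := ae_restrict_of_ae (ae_restrict_mem hS)
  have hGπ : MemLp (fun x => G (π x)) 2 ν := h.memLp_comp_chartCoord hd hd3 hS hG
  have hadj : AEStronglyMeasurable (fun x => ContinuousLinearMap.adjoint (fderiv ℝ π x)) ν := by
    refine ContinuousOn.aestronglyMeasurable ?_ measurableSet_ball
    exact (LinearIsometryEquiv.continuous _).comp_continuousOn
      (((h.contDiffOn_chartCoord hd3).continuousOn_fderiv_of_isOpen Φ.open_source (by simp)).mono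
        h.ball_subset_source)
  refine ⟨hw.restrict _, fun x => ContinuousLinearMap.adjoint (fderiv ℝ π x) (G (π x)), ?_, ?_⟩
  · refine hGπ.of_le_mul (c := L) ?_ ?_
    · exact aestronglyMeasurable_clm_apply hadj hGπ.1
    · filter_upwards [hmem] with x hx
      exact ContinuousLinearMap.le_of_opNorm_le _ (hπL x hx) _
  intro ε hε
  set C : ℝ≥0∞ := ((L : ℝ≥0∞) ^ d) ^ (1 / (2 : ℝ≥0∞)).toReal with hC
  have hCt : C ≠ ⊤ := ENNReal.rpow_ne_top_of_nonneg (by positivity) (by finiteness)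
  obtain ⟨δ₁, hδ₁, hδ₁ε⟩ := exists_pos_mul_le hCt hε
  obtain ⟨δ₂, hδ₂, hδ₂ε⟩ := exists_pos_mul_le (C := (L : ℝ≥0∞) * C) (by finiteness) hε
  obtain ⟨f, hf, hf1, hf2⟩ := happ (min δ₁ δ₂) (lt_min hδ₁ hδ₂)
  have hfπ : ContDiffOn ℝ ∞ (fun x => f (π x)) Φ.source :=
    hf.comp_contDiffOn (h.contDiffOn_chartCoord hd3)
  obtain ⟨φ, hφ, hφeq⟩ := exists_isTest_eqOn_ball Φ.open_source h.r_pos h.ball_subset hfπ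
  have hgc : Continuous (gradient f) :=
    (LinearIsometryEquiv.continuous _).comp (hf.continuous_fderiv (by simp))
  have m1 : AEStronglyMeasurable (fun y => f y - w (Φ.symm (pad d y)))
      (volume.restrict (halfBall d (Φ p) s)) := hf.continuous.aestronglyMeasurable.sub hg2.1
  have m2 : AEStronglyMeasurable (fun y => gradient f y - G y)
      (volume.restrict (halfBall d (Φ p) s)) := hgc.aestronglyMeasurable.sub hG.1
  have b1 := h.eLpNorm_comp_chartCoord_le hd hd3 hS m1
  have b2 := h.eLpNorm_comp_chartCoord_le hd hd3 hS m2
  rw [← hC, ← hν] at b1 b2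
  refine ⟨φ, hφ, ?_, ?_⟩
  · calc eLpNorm (fun x => φ x - w x) 2 ν
        = eLpNorm (fun x => f (π x) - w (Φ.symm (pad d (π x)))) 2 ν := by
          refine eLpNorm_congr_ae ?_
          filter_upwards [hmem, hmemS] with x hx hxS
          rw [(hφeq x hx).1, h.pad_chartCoord hd3 hx hxS, Φ.left_inv (h.ball_subset_source hx)]
      _ ≤ C * eLpNorm (fun y => f y - w (Φ.symm (pad d y))) 2
            (volume.restrict (halfBall d (Φ p) s)) :=
          b1
      _ ≤ C * δ₁ := by gcongr; exact hf1.trans (min_le_left _ _)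
      _ ≤ ε := hδ₁ε
  · calc eLpNorm (fun x => gradient φ x -
          ContinuousLinearMap.adjoint (fderiv ℝ π x) (G (π x))) 2 ν
        ≤ ENNReal.ofReal L * eLpNorm (fun x => gradient f (π x) - G (π x)) 2 ν := by
          refine eLpNorm_le_mul_eLpNorm_of_ae_le_mul ?_ 2
          filter_upwards [hmem] with x hx
          rw [(hφeq x hx).2, gradient_comp ((hf.differentiable (by simp)) _) (hπd x hx)]
          set A := ContinuousLinearMap.adjoint (fderiv ℝ π x) with hA
          have hAL : ‖A‖ ≤ L := hπL x hx
          calc ‖A (gradient f (π x)) - A (G (π x))‖ = ‖A (gradient f (π x) - G (π x))‖ := by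
                rw [A.map_sub]
            _ ≤ L * ‖gradient f (π x) - G (π x)‖ := A.le_of_opNorm_le hAL _
      _ ≤ L * (C * eLpNorm (fun y => gradient f y - G y) 2
            (volume.restrict (halfBall d (Φ p) s))) := by
          rw [ENNReal.ofReal_coe_nnreal]
          gcongr
      _ ≤ L * (C * δ₂) := by gcongr; exact hf2.trans (min_le_right _ _)
      _ ≤ ε := by rwa [← mul_assoc]

end ChartBall

/-! ### Transversality -/

/-- The last two coordinates of a point of `ℝ³`. -/
noncomputable def lastTwo : E3 →L[ℝ] EuclideanSpace ℝ (Fin 2) :=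
  (EuclideanSpace.equiv (Fin 2) ℝ).symm.toContinuousLinearMap.comp
    (ContinuousLinearMap.pi fun j => EuclideanSpace.proj (Fin.succ j))

lemma lastTwo_apply (x : E3) (j : Fin 2) : lastTwo x j = x j.succ := rfl

lemma lipschitzWith_lastTwo : LipschitzWith 1 lastTwo := by
  refine LipschitzWith.of_dist_le_mul fun x y => ?_
  simp only [EuclideanSpace.dist_eq, NNReal.coe_one, one_mul]
  refine Real.sqrt_le_sqrt ?_
  simp only [Fin.sum_univ_succ, lastTwo_apply]
  simp

/-- A defining function is constant on `S`, so its differential vanishes on the tangent space. -/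
lemma tangentSpace_le_ker {S : Set E3} {F : E3 → ℝ} {F' : E3 →L[ℝ] ℝ} {p : E3}
    (hF : HasFDerivAt F F' p) (h0 : ∀ᶠ x in 𝓝 p, x ∈ S → F x = 0) (hp : p ∈ S) :
    tangentSpace S p ≤ LinearMap.ker (F' : E3 →ₗ[ℝ] ℝ) := by
  refine Submodule.span_le.2 fun y hy => ?_
  have h1 : HasFDerivWithinAt F (0 : E3 →L[ℝ] ℝ) S p := by
    refine (hasFDerivWithinAt_const (0 : ℝ) p S).congr_of_eventuallyEq ?_
      (mem_of_mem_nhds h0 hp)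
    exact eventually_nhdsWithin_iff.2 h0
  have := hF.hasFDerivWithinAt.unique_on h1 hy
  simpa using this

lemma eventually_norm_sub_le {F : Type*} [NormedAddCommGroup F] [NormedSpace ℝ F] {Θ : E3 → F}
    {Θ' : E3 →L[ℝ] F} {p : E3} (hΘ : HasFDerivAt Θ Θ' p) (hinj : ∀ v, Θ' v = 0 → v = 0) :
    ∃ C > 0, ∀ᶠ x in 𝓝 p, ‖x - p‖ ≤ C * ‖Θ x - Θ p‖ := by
  obtain ⟨K, hK, hanti⟩ := LinearMap.exists_antilipschitzWith (Θ' : E3 →ₗ[ℝ] F)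
    (LinearMap.ker_eq_bot'.2 hinj)
  have hK' : (0 : ℝ) < K := hK
  refine ⟨2 * K, by positivity, ?_⟩
  have hev := hΘ.isLittleO.def (c := 1 / (2 * K)) (by positivity)
  filter_upwards [hev] with x hx
  have h1 : ‖x - p‖ ≤ K * ‖Θ' (x - p)‖ := by
    simpa using hanti.le_mul_norm_sub 0 (x - p)
  have h2 : ‖Θ' (x - p)‖ ≤ ‖Θ x - Θ p‖ + 1 / (2 * K) * ‖x - p‖ := by
    calc ‖Θ' (x - p)‖ = ‖(Θ x - Θ p) - (Θ x - Θ p - Θ' (x - p))‖ := by rw [sub_sub_cancel]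
      _ ≤ _ := (norm_sub_le _ _).trans (add_le_add le_rfl hx)
  have h3 : ‖x - p‖ ≤ K * ‖Θ x - Θ p‖ + ‖x - p‖ / 2 := by
    calc ‖x - p‖ ≤ K * (‖Θ x - Θ p‖ + 1 / (2 * K) * ‖x - p‖) := h1.trans (by gcongr)
      _ = _ := by field_simp
  linarith

lemma IsSliceChart.exists_fderiv {d : ℕ} {S : Set E3} {Φ : OpenPartialHomeomorph E3 E3}
    (h : IsSliceChart d S Φ) {p : E3} (hp : p ∈ Φ.source) :
    ∃ A B : E3 →L[ℝ] E3, HasFDerivAt Φ A p ∧ (∀ v, B (A v) = v) ∧ ∀ v, A (B v) = v := by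
  have hA : DifferentiableAt ℝ Φ p :=
    (h.smooth.contDiffAt (Φ.open_source.mem_nhds hp)).differentiableAt (by simp)
  have hB : DifferentiableAt ℝ Φ.symm (Φ p) :=
    (h.smooth_symm.contDiffAt (Φ.open_target.mem_nhds (Φ.map_source hp))).differentiableAt (by simp)
  refine ⟨fderiv ℝ Φ p, fderiv ℝ Φ.symm (Φ p), hA.hasFDerivAt, ?_, ?_⟩
  · have h1 := hB.hasFDerivAt.comp p hA.hasFDerivAt
    have h2 : HasFDerivAt (Φ.symm ∘ Φ) (ContinuousLinearMap.id ℝ E3) p :=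
      (hasFDerivAt_id p).congr_of_eventuallyEq (Φ.eventually_left_inverse hp)
    exact fun v => DFunLike.congr_fun (h1.unique h2) v
  · have hA' : HasFDerivAt Φ (fderiv ℝ Φ p) (Φ.symm (Φ p)) := by
      rw [Φ.left_inv hp]; exact hA.hasFDerivAt
    have h1 := hA'.comp (Φ p) hB.hasFDerivAt
    have h2 : HasFDerivAt (Φ ∘ Φ.symm) (ContinuousLinearMap.id ℝ E3) (Φ p) :=
      (hasFDerivAt_id (Φ p)).congr_of_eventuallyEq
        (Φ.eventually_right_inverse (Φ.map_source hp))
    exact fun v => DFunLike.congr_fun (h1.unique h2) v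

/-- Transversality: on the surface, the distance to an intersection point is controlled by the
transverse chart coordinates of the curve. -/
lemma Transversal.exists_norm_sub_le {S₁ S₂ : Set E3} (hT : Transversal S₁ S₂)
    {Φ₁ Φ₂ : OpenPartialHomeomorph E3 E3} (h₁ : IsSliceChart 1 S₁ Φ₁) (h₂ : IsSliceChart 2 S₂ Φ₂)
    {p : E3} (hp₁ : p ∈ S₁) (hp₂ : p ∈ S₂) (hs₁ : p ∈ Φ₁.source) (hs₂ : p ∈ Φ₂.source) :
    ∃ C > 0, ∀ᶠ x in 𝓝 p, x ∈ S₂ → ‖x - p‖ ≤ C * ‖lastTwo (Φ₁ x)‖ := by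
  obtain ⟨A, A', hA, hA'A, hAA'⟩ := h₁.exists_fderiv hs₁
  obtain ⟨B, B', hB, hB'B, hBB'⟩ := h₂.exists_fderiv hs₂
  let pr : Fin 3 → E3 →L[ℝ] ℝ := fun j => EuclideanSpace.proj j
  have hcoord : ∀ j, HasFDerivAt (fun x => Φ₁ x j) ((pr j).comp A) p := fun j =>
    (pr j).hasFDerivAt.comp p hA
  have hcoord₂ : HasFDerivAt (fun x => Φ₂ x 2) ((pr 2).comp B) p := (pr 2).hasFDerivAt.comp p hB
  have z₁ : ∀ x ∈ Φ₁.source, x ∈ S₁ → ∀ j : Fin 3, 1 ≤ (j : ℕ) → Φ₁ x j = 0 :=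
    fun x hx hxS => ((h₁.slice x hx).1 hxS).2
  have z₂ : ∀ x ∈ Φ₂.source, x ∈ S₂ → Φ₂ x 2 = 0 :=
    fun x hx hxS => ((h₂.slice x hx).1 hxS).2 2 le_rfl
  have k₁ : ∀ j : Fin 3, 1 ≤ (j : ℕ) →
      tangentSpace S₁ p ≤ LinearMap.ker ((pr j).comp A : E3 →ₗ[ℝ] ℝ) := fun j hj =>
    tangentSpace_le_ker (hcoord j) (by
      filter_upwards [Φ₁.open_source.mem_nhds hs₁] with x hx hxS using z₁ x hx hxS j hj) hp₁
  have k₂ : tangentSpace S₂ p ≤ LinearMap.ker ((pr 2).comp B : E3 →ₗ[ℝ] ℝ) :=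
    tangentSpace_le_ker hcoord₂ (by
      filter_upwards [Φ₂.open_source.mem_nhds hs₂] with x hx hxS using z₂ x hx hxS) hp₂
  let Θ : E3 → EuclideanSpace ℝ (Fin 2) × ℝ := fun x => (lastTwo (Φ₁ x), Φ₂ x 2)
  have hΘ : HasFDerivAt Θ ((lastTwo.comp A).prod ((pr 2).comp B)) p :=
    (lastTwo.hasFDerivAt.comp p hA).prodMk hcoord₂
  have hinj : ∀ v, ((lastTwo.comp A).prod ((pr 2).comp B)) v = 0 → v = 0 := by
    intro v hv
    by_contra hv0
    have hvA : ∀ j : Fin 2, A v j.succ = 0 := fun j => by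
      have h1 : lastTwo (A v) = 0 := congrArg Prod.fst hv
      rw [← lastTwo_apply, h1]; rfl
    have hvB : B v 2 = 0 := congrArg Prod.snd hv
    have hA0 : A v 0 ≠ 0 := by
      intro h0
      refine hv0 ?_
      rw [← hA'A v]
      have : A v = 0 := by
        ext j
        refine Fin.cases h0 hvA j
      rw [this, map_zero]
    -- the tangent line of the curve is spanned by `v`, which is also tangent to the surface
    have hle : tangentSpace S₁ p ≤ LinearMap.ker ((pr 2).comp B : E3 →ₗ[ℝ] ℝ) := by
      intro k hk
      have hkA : ∀ j : Fin 2, A k j.succ = 0 := fun j => k₁ j.succ (by simp) hk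
      have hkv : k = (A k 0 / A v 0) • v := by
        rw [← sub_eq_zero, ← hA'A (k - _)]
        have : A (k - (A k 0 / A v 0) • v) = 0 := by
          ext j
          refine Fin.cases ?_ (fun j => ?_) j
          · simp [hA0]
          · simp [hkA j, hvA j]
        rw [this, map_zero]
      have : B k 2 = 0 := by rw [hkv]; simp [hvB]
      exact this
    have htop := hT p ⟨hp₁, hp₂⟩
    have hker : B' (EuclideanSpace.single 2 1) ∈
        LinearMap.ker ((pr 2).comp B : E3 →ₗ[ℝ] ℝ) :=
      (sup_le hle k₂) (htop ▸ Submodule.mem_top)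
    have : B (B' (EuclideanSpace.single 2 1)) 2 = 0 := hker
    rw [hBB'] at this
    simp at this
  obtain ⟨C, hC, hev⟩ := eventually_norm_sub_le hΘ hinj
  refine ⟨C, hC, ?_⟩
  filter_upwards [hev, Φ₂.open_source.mem_nhds hs₂] with x hx hxs hxS
  have hΘp : Θ p = 0 := by
    refine Prod.ext ?_ (z₂ p hs₂ hp₂)
    ext j
    exact z₁ p hs₁ hp₁ j.succ (by simp)
  have hΘx : ‖Θ x‖ = ‖lastTwo (Φ₁ x)‖ := by
    simp [Θ, Prod.norm_def, z₂ x hxs hxS]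
  rwa [hΘp, sub_zero, hΘx] at hx

/-! ### Quadratic growth and dyadic sums -/

lemma ChartBall.surfaceMeasure_closedBall_le {S : Set E3} {Φ : OpenPartialHomeomorph E3 E3} {p : E3}
    {r s : ℝ} {L : ℝ≥0} (h : ChartBall 2 S Φ p r s L) (hS : MeasurableSet S) :
    ∃ c : ℝ, 0 ≤ c ∧ ∀ t, 0 ≤ t → (surfaceMeasure 2 S).restrict (Metric.ball p r)
      (Metric.closedBall p t) ≤ ENNReal.ofReal (c * t ^ 2) := by
  set V : ℝ≥0∞ := volume (Metric.ball (0 : EuclideanSpace ℝ (Fin 2)) 1) with hV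
  have hVt : V ≠ ⊤ := measure_ball_lt_top.ne
  refine ⟨(L : ℝ) ^ 2 * (L : ℝ) ^ 2 * V.toReal, by positivity, fun t ht => ?_⟩
  set ν := (surfaceMeasure 2 S).restrict (Metric.ball p r) with hν
  set π := chartCoord 2 (by norm_num) Φ
  have hmem : ∀ᵐ x ∂ν, x ∈ Metric.ball p r := ae_restrict_mem measurableSet_ball
  have hlip := h.lipschitzOnWith_chartCoord (Or.inr rfl) (by norm_num)
  have hmeas := h.aemeasurable_chartCoord (by norm_num) (surfaceMeasure 2 S)
  have hle := h.map_surfaceMeasure_le (Or.inr rfl) (by norm_num) hS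
  calc ν (Metric.closedBall p t) ≤ ν (π ⁻¹' Metric.closedBall (π p) (L * t)) := by
        refine measure_mono_ae ?_
        filter_upwards [hmem] with x hx hxt
        exact (hlip.dist_le_mul x (h.ball_subset_ball_two hx) p
          (Metric.mem_ball_self (by linarith [h.r_pos]))).trans
          (mul_le_mul_of_nonneg_left hxt L.coe_nonneg)
    _ = ν.map π (Metric.closedBall (π p) (L * t)) :=
        (Measure.map_apply_of_aemeasurable hmeas measurableSet_closedBall).symm
    _ ≤ ((L : ℝ≥0∞) ^ 2 • volume.restrict (halfBall 2 (Φ p) s))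
          (Metric.closedBall (π p) (L * t)) := hle _
    _ ≤ (L : ℝ≥0∞) ^ 2 * volume (Metric.closedBall (π p) (L * t)) := by
        rw [Measure.smul_apply, smul_eq_mul]
        exact mul_le_mul' le_rfl (Measure.restrict_apply_le _ _)
    _ = ENNReal.ofReal ((L : ℝ) ^ 2 * (L : ℝ) ^ 2 * V.toReal * t ^ 2) := by
        rw [Measure.addHaar_closedBall _ _ (by positivity), ← hV, finrank_euclideanSpace_fin,
          ← ENNReal.ofReal_toReal hVt, ← ENNReal.ofReal_coe_nnreal,
          ← ENNReal.ofReal_pow L.coe_nonneg, ← ENNReal.ofReal_mul (by positivity),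
          ← ENNReal.ofReal_mul (by positivity), ENNReal.toReal_ofReal (by positivity)]
        congr 1; ring

/-- A sum of distinct powers of two is at most twice its largest term, so squaring it costs only a
constant against the sum of the squares. -/
lemma sq_sum_dyadic_le (N : ℕ) (a : ℕ → ℝ) (ha : ∀ k, a k = 0 ∨ a k = 1) :
    (∑ k ∈ Finset.range N, 2 ^ k * a k) ^ 2 ≤ 4 * ∑ k ∈ Finset.range N, 4 ^ k * a k := by
  have hb : ∀ N, ∑ k ∈ Finset.range N, 2 ^ k * a k ≤ 2 ^ N := by
    intro N
    induction N with
    | zero => simp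
    | succ n ih =>
      rw [Finset.sum_range_succ, pow_succ]
      rcases ha n with h | h <;> rw [h] <;> nlinarith [pow_pos (zero_lt_two' ℝ) n]
  induction N with
  | zero => simp
  | succ n ih =>
    rw [Finset.sum_range_succ, Finset.sum_range_succ]
    have h4 : (4 : ℝ) ^ n = 2 ^ n * 2 ^ n := by rw [← mul_pow]; norm_num
    rcases ha n with h | h
    · rw [h]; simpa using ih
    · rw [h, h4]
      nlinarith [hb n, pow_pos (zero_lt_two' ℝ) n]

/-- For a measure with quadratic growth at `p` the square of `∑_{k<N} 2ᵏ 1_{B(p, c 2⁻ᵏ)}` has integral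
`O(N)`, so that its average over `k < N` is small. -/
lemma eLpNorm_dyadic_le {ν : Measure E3} {p : E3} {c C : ℝ} (hc : 0 ≤ c)
    (hν : ∀ t, 0 ≤ t → ν (Metric.closedBall p t) ≤ ENNReal.ofReal (C * t ^ 2)) (N : ℕ) :
    eLpNorm (fun x => ∑ k ∈ Finset.range N,
      2 ^ k * (Metric.closedBall p (c / 2 ^ k)).indicator (fun _ => (1 : ℝ)) x) 2 ν ≤
        ENNReal.ofReal (4 * C * c ^ 2 * N) ^ (1 / 2 : ℝ) := by
  rw [eLpNorm_eq_lintegral_rpow_enorm_toReal (by norm_num) (by norm_num)]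
  simp only [ENNReal.toReal_ofNat, ENNReal.rpow_ofNat]
  gcongr
  set a : E3 → ℕ → ℝ := fun x k => (Metric.closedBall p (c / 2 ^ k)).indicator (fun _ => (1 : ℝ)) x
    with ha
  have ha01 : ∀ x k, a x k = 0 ∨ a x k = 1 := fun x k => by
    by_cases hx : x ∈ Metric.closedBall p (c / 2 ^ k)
    · right; exact Set.indicator_of_mem hx _
    · left; exact Set.indicator_of_notMem hx _
  have ha0 : ∀ x k, 0 ≤ a x k := fun x k => by rcases ha01 x k with h | h <;> rw [h]; norm_num
  have hpt : ∀ x, ‖∑ k ∈ Finset.range N, 2 ^ k * a x k‖ₑ ^ 2 ≤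
      ∑ k ∈ Finset.range N, (Metric.closedBall p (c / 2 ^ k)).indicator
        (fun _ => ENNReal.ofReal (4 * 4 ^ k)) x := by
    intro x
    rw [Real.enorm_of_nonneg (Finset.sum_nonneg fun k _ => mul_nonneg (by positivity) (ha0 x k)),
      ← ENNReal.ofReal_pow (Finset.sum_nonneg fun k _ => mul_nonneg (by positivity) (ha0 x k))]
    refine (ENNReal.ofReal_le_ofReal (sq_sum_dyadic_le N (a x) (ha01 x))).trans (le_of_eq ?_)
    rw [Finset.mul_sum, ENNReal.ofReal_sum_of_nonneg
      fun k _ => mul_nonneg (by norm_num) (mul_nonneg (by positivity) (ha0 x k))]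
    refine Finset.sum_congr rfl fun k _ => ?_
    by_cases hx : x ∈ Metric.closedBall p (c / 2 ^ k) <;> simp [a, hx]
  calc ∫⁻ x, ‖∑ k ∈ Finset.range N, 2 ^ k * a x k‖ₑ ^ 2 ∂ν
      ≤ ∫⁻ x, ∑ k ∈ Finset.range N, (Metric.closedBall p (c / 2 ^ k)).indicator
        (fun _ => ENNReal.ofReal (4 * 4 ^ k)) x ∂ν := lintegral_mono hpt
    _ = ∑ k ∈ Finset.range N, ENNReal.ofReal (4 * 4 ^ k) * ν (Metric.closedBall p (c / 2 ^ k)) := by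
        rw [lintegral_finsetSum _ fun k _ => measurable_const.indicator measurableSet_closedBall]
        refine Finset.sum_congr rfl fun k _ => ?_
        rw [lintegral_indicator_const measurableSet_closedBall]
    _ ≤ ∑ k ∈ Finset.range N, ENNReal.ofReal (4 * C * c ^ 2) := by
        refine Finset.sum_le_sum fun k _ => ?_
        refine (mul_le_mul' le_rfl (hν _ (by positivity))).trans (le_of_eq ?_)
        rw [← ENNReal.ofReal_mul (by positivity)]
        congr 1
        have h4 : (4 : ℝ) ^ k = 2 ^ k * 2 ^ k := by rw [← mul_pow]; norm_num
        rw [h4]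
        field_simp
    _ = ENNReal.ofReal (4 * C * c ^ 2 * N) := by
        rw [Finset.sum_const, Finset.card_range, nsmul_eq_mul, mul_comm _ (N : ℝ),
          ENNReal.ofReal_mul (Nat.cast_nonneg N), ENNReal.ofReal_natCast]

lemma exists_nat_mul_le {M K : ℝ} (hM : 0 ≤ M) (hK : 0 ≤ K) {ε : ℝ≥0∞} (hε : 0 < ε) :
    ∃ N : ℕ, 0 < N ∧ ENNReal.ofReal (M / N) * ENNReal.ofReal (K * N) ^ (1 / 2 : ℝ) ≤ ε := by
  have hlim : Tendsto (fun N : ℕ => ENNReal.ofReal (M * √K * (√(N : ℝ))⁻¹)) atTop (𝓝 0) := by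
    rw [← ENNReal.ofReal_zero]
    refine ENNReal.tendsto_ofReal ?_
    rw [← mul_zero (M * √K)]
    exact (tendsto_inv_atTop_zero.comp
      (Real.tendsto_sqrt_atTop.comp tendsto_natCast_atTop_atTop)).const_mul _
  obtain ⟨N, hN, hN0⟩ := ((hlim.eventually (Iio_mem_nhds hε)).and (eventually_gt_atTop 0)).exists
  refine ⟨N, hN0, le_trans (le_of_eq ?_) (le_of_lt hN)⟩
  have hN0' : (0 : ℝ) < N := by exact_mod_cast hN0
  rw [ENNReal.ofReal_rpow_of_nonneg (by positivity) (by norm_num), ← Real.sqrt_eq_rpow,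
    ← ENNReal.ofReal_mul (by positivity), Real.sqrt_mul hK]
  congr 1
  have hs : 0 < √(N : ℝ) := Real.sqrt_pos.2 hN0'
  field_simp
  rw [Real.sq_sqrt hN0'.le]
  ring

/-! ### Cutoffs at an intersection point -/

/-- The dyadic average of the rescaled bumps `η (2ᵏ y)`, a smooth substitute for the logarithmic
cutoff at the origin of the plane. -/
noncomputable def dyadicCutoff (η : EuclideanSpace ℝ (Fin 2) → ℝ) (N : ℕ)
    (y : EuclideanSpace ℝ (Fin 2)) : ℝ :=
  (N : ℝ)⁻¹ * ∑ k ∈ Finset.range N, η ((2 : ℝ) ^ k • y)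

lemma contDiff_dyadicCutoff {η : EuclideanSpace ℝ (Fin 2) → ℝ} (hη : ContDiff ℝ ∞ η) (N : ℕ) :
    ContDiff ℝ ∞ (dyadicCutoff η N) :=
  contDiff_const.mul (ContDiff.sum fun k _ => hη.comp (contDiff_const_smul ((2 : ℝ) ^ k)))

lemma norm_fderiv_dyadicCutoff_le {η : EuclideanSpace ℝ (Fin 2) → ℝ} (hη : ContDiff ℝ ∞ η) (N : ℕ)
    (y : EuclideanSpace ℝ (Fin 2)) :
    ‖fderiv ℝ (dyadicCutoff η N) y‖ ≤
      (N : ℝ)⁻¹ * ∑ k ∈ Finset.range N, 2 ^ k * ‖fderiv ℝ η ((2 : ℝ) ^ k • y)‖ := by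
  have hk : ∀ k : ℕ, HasFDerivAt (fun y => η ((2 : ℝ) ^ k • y))
      ((fderiv ℝ η ((2 : ℝ) ^ k • y)).comp ((2 : ℝ) ^ k • ContinuousLinearMap.id ℝ _)) y := fun k =>
    ((hη.differentiable (by simp)) _).hasFDerivAt.comp y ((hasFDerivAt_id y).const_smul ((2 : ℝ) ^ k))
  have h : HasFDerivAt (dyadicCutoff η N) _ y :=
    (HasFDerivAt.fun_sum fun k (_ : k ∈ Finset.range N) => hk k).const_mul (N : ℝ)⁻¹
  rw [h.fderiv, norm_smul, norm_inv, Real.norm_natCast]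
  gcongr
  refine (norm_sum_le _ _).trans (Finset.sum_le_sum fun k _ => ?_)
  rw [ContinuousLinearMap.comp_smul, ContinuousLinearMap.comp_id, norm_smul]
  simp

/-- Near an intersection point of a curve and a transversal surface, the dyadic cutoffs in the
transverse coordinates of the curve are `1` around the curve and small on the surface. -/
lemma hasCutoffs_of_chartBall {S₁ S₂ : Set E3} (hS₁ : MeasurableSet S₁) (hS₂ : MeasurableSet S₂)
    {Φ₁ Φ₂ : OpenPartialHomeomorph E3 E3} {p : E3} {r s₁ s₂ C : ℝ} {L₁ L₂ : ℝ≥0}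
    (h₁ : ChartBall 1 S₁ Φ₁ p r s₁ L₁) (h₂ : ChartBall 2 S₂ Φ₂ p r s₂ L₂) (hC : 0 < C)
    (hle : ∀ x ∈ Metric.ball p r, x ∈ S₂ → ‖x - p‖ ≤ C * ‖lastTwo (Φ₁ x)‖) :
    HasCutoffs ((surfaceMeasure 1 S₁).restrict (Metric.ball p r))
      ((surfaceMeasure 2 S₂).restrict (Metric.ball p r)) := by
  intro ε hε
  set ν := (surfaceMeasure 1 S₁).restrict (Metric.ball p r) with hν
  set τ := (surfaceMeasure 2 S₂).restrict (Metric.ball p r) with hτ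
  let q : E3 → EuclideanSpace ℝ (Fin 2) := fun x => lastTwo (Φ₁ x)
  have hq : ContDiffOn ℝ ∞ q Φ₁.source := lastTwo.contDiff.comp_contDiffOn h₁.slice.smooth
  have hqL : ∀ x ∈ Metric.ball p r, ‖fderiv ℝ q x‖ ≤ L₁ := fun x hx => by
    have hlip := lipschitzWith_lastTwo.comp_lipschitzOnWith h₁.lipschitz
    rw [one_mul] at hlip
    exact norm_fderiv_le_of_lipschitzOn ℝ
      (Metric.isOpen_ball.mem_nhds (h₁.ball_subset_ball_two hx)) hlip
  have hqd : ∀ x ∈ Metric.ball p r, ContDiffAt ℝ ∞ q x := fun x hx =>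
    hq.contDiffAt (Φ₁.open_source.mem_nhds (h₁.ball_subset_source hx))
  let η : ContDiffBump (0 : EuclideanSpace ℝ (Fin 2)) := ⟨1, 2, one_pos, one_lt_two⟩
  have hη : ContDiff ℝ ∞ (η : EuclideanSpace ℝ (Fin 2) → ℝ) := η.contDiff
  obtain ⟨M, hM⟩ := (η.hasCompactSupport.fderiv (𝕜 := ℝ)).exists_bound_of_continuous
    (hη.continuous_fderiv (by simp))
  have hM0 : 0 ≤ M := (norm_nonneg _).trans (hM 0)
  obtain ⟨c, hc, hgrowth⟩ := h₂.surfaceMeasure_closedBall_le hS₂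
  set M' : ℝ := max 1 (M * L₁) with hM'
  have hM'0 : 0 ≤ M' := zero_le_one.trans (le_max_left _ _)
  obtain ⟨N, hN, hNε⟩ := exists_nat_mul_le (M := M') (K := 4 * c * (2 * C) ^ 2) hM'0
    (by positivity) hε
  have hN' : (0 : ℝ) < N := by exact_mod_cast hN
  obtain ⟨κ, hκ, hκeq⟩ := exists_isTest_eqOn_ball Φ₁.open_source h₁.r_pos h₁.ball_subset
    ((contDiff_dyadicCutoff hη N).comp_contDiffOn hq)
  simp only [Function.comp_apply] at hκeq
  -- the cutoff is `1` where the transverse coordinates are less than `2⁻ᴺ`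
  have hone : ∀ y : EuclideanSpace ℝ (Fin 2), ‖y‖ < 1 / 2 ^ N → dyadicCutoff η N y = 1 := by
    intro y hy
    rw [dyadicCutoff, Finset.sum_congr rfl (g := fun _ => (1 : ℝ))]
    · simp [hN'.ne']
    · intro k hk
      refine η.one_of_mem_closedBall (mem_closedBall_zero_iff.2 ?_)
      rw [norm_smul, norm_pow, Real.norm_ofNat]
      calc (2 : ℝ) ^ k * ‖y‖ ≤ 2 ^ N * (1 / 2 ^ N) := by
            gcongr
            · norm_num
            · exact (Finset.mem_range.1 hk).le
        _ = 1 := by field_simp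
  have hmemν : ∀ᵐ x ∂ν, x ∈ Metric.ball p r ∧ x ∈ S₁ :=
    (ae_restrict_mem measurableSet_ball).and (ae_restrict_of_ae (ae_restrict_mem hS₁))
  have hmemτ : ∀ᵐ x ∂τ, x ∈ Metric.ball p r ∧ x ∈ S₂ :=
    (ae_restrict_mem measurableSet_ball).and (ae_restrict_of_ae (ae_restrict_mem hS₂))
  have hνone : ∀ x ∈ Metric.ball p r, x ∈ S₁ → κ x = 1 ∧ gradient κ x = 0 := by
    intro x hx hxS
    have hq0 : q x = 0 := by
      ext j
      exact ((h₁.slice.slice x (h₁.ball_subset_source hx)).1 hxS).2 j.succ (by simp)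
    have hev : κ =ᶠ[𝓝 x] fun _ => 1 := by
      have : ∀ᶠ y in 𝓝 x, ‖q y‖ < 1 / 2 ^ N := by
        refine (hqd x hx).continuousAt.norm.eventually (Iio_mem_nhds ?_)
        simp only [hq0, norm_zero]; positivity
      filter_upwards [this, Metric.isOpen_ball.mem_nhds hx] with y hy hyb
      rw [(hκeq y hyb).1, hone _ hy]
    refine ⟨hev.self_of_nhds, ?_⟩
    rw [gradient_eq_toDual_symm, hev.fderiv_eq]
    simp
  -- on the surface, both the cutoff and its gradient are dominated by the dyadic average
  have hfar : ∀ x ∈ Metric.ball p r, x ∈ S₂ → ∀ k : ℕ, x ∉ Metric.closedBall p (2 * C / 2 ^ k) →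
      (2 : ℝ) ^ k • q x ∉ tsupport η := by
    intro x hx hxS k hxk hmem
    rw [η.tsupport_eq, mem_closedBall_zero_iff, norm_smul, norm_pow, Real.norm_ofNat] at hmem
    refine hxk (mem_closedBall_iff_norm.2 ((hle x hx hxS).trans ?_))
    rw [le_div_iff₀ (by positivity)]
    have : C * (2 ^ k * ‖q x‖) ≤ C * 2 := mul_le_mul_of_nonneg_left hmem hC.le
    linarith
  have hbound : ∀ᵐ x ∂τ, ‖κ x‖ ≤ M' / N * ‖∑ k ∈ Finset.range N, 2 ^ k *
        (Metric.closedBall p (2 * C / 2 ^ k)).indicator (fun _ => (1 : ℝ)) x‖ ∧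
      ‖gradient κ x‖ ≤ M' / N * ‖∑ k ∈ Finset.range N, 2 ^ k *
        (Metric.closedBall p (2 * C / 2 ^ k)).indicator (fun _ => (1 : ℝ)) x‖ := by
    filter_upwards [hmemτ] with x ⟨hx, hxS⟩
    have hind : ∀ k, 0 ≤ (Metric.closedBall p (2 * C / 2 ^ k)).indicator (fun _ => (1 : ℝ)) x :=
      fun k => Set.indicator_nonneg (fun _ _ => zero_le_one) x
    rw [Real.norm_of_nonneg (Finset.sum_nonneg fun k _ => mul_nonneg (by positivity) (hind k)),
      (hκeq x hx).1, (hκeq x hx).2, div_eq_inv_mul, mul_assoc, Finset.mul_sum]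
    constructor
    · rw [dyadicCutoff, norm_mul, norm_inv, Real.norm_natCast]
      gcongr
      refine (norm_sum_le _ _).trans (Finset.sum_le_sum fun k _ => ?_)
      by_cases hxk : x ∈ Metric.closedBall p (2 * C / 2 ^ k)
      · rw [Set.indicator_of_mem hxk, mul_one, Real.norm_of_nonneg η.nonneg]
        calc η ((2 : ℝ) ^ k • q x) ≤ 1 * 1 := by rw [one_mul]; exact η.le_one
          _ ≤ M' * 2 ^ k := by
            gcongr
            · exact le_max_left _ _
            · exact one_le_pow₀ one_le_two
      · rw [image_eq_zero_of_notMem_tsupport (hfar x hx hxS k hxk), norm_zero]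
        exact mul_nonneg hM'0 (mul_nonneg (by positivity) (hind k))
    · have hcomp : fderiv ℝ (fun x => dyadicCutoff η N (q x)) x =
          (fderiv ℝ (dyadicCutoff η N) (q x)).comp (fderiv ℝ q x) :=
        fderiv_comp x ((contDiff_dyadicCutoff hη N).differentiable (by simp) _)
          ((hqd x hx).differentiableAt (by simp))
      have e1 : gradient (dyadicCutoff η N ∘ q) x =
        gradient (fun x => dyadicCutoff η N (q x)) x := rfl
      rw [e1, norm_gradient, hcomp]
      calc _ ≤ ‖fderiv ℝ (dyadicCutoff η N) (q x)‖ * ‖fderiv ℝ q x‖ :=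
            ContinuousLinearMap.opNorm_comp_le _ _
        _ ≤ ((N : ℝ)⁻¹ * ∑ k ∈ Finset.range N,
              2 ^ k * ‖fderiv ℝ η ((2 : ℝ) ^ k • q x)‖) * L₁ := by
            gcongr
            · exact norm_fderiv_dyadicCutoff_le hη N (q x)
            · exact hqL x hx
        _ = (N : ℝ)⁻¹ * ∑ k ∈ Finset.range N,
              2 ^ k * (‖fderiv ℝ η ((2 : ℝ) ^ k • q x)‖ * L₁) := by
            rw [mul_assoc, Finset.sum_mul]
            simp only [mul_assoc]
        _ ≤ _ := by
            refine mul_le_mul_of_nonneg_left (Finset.sum_le_sum fun k _ => ?_) (by positivity)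
            by_cases hxk : x ∈ Metric.closedBall p (2 * C / 2 ^ k)
            · rw [Set.indicator_of_mem hxk, mul_one, mul_comm M']
              gcongr
              exact (mul_le_mul_of_nonneg_right (hM _) L₁.coe_nonneg).trans (le_max_right _ _)
            · have : fderiv ℝ η ((2 : ℝ) ^ k • q x) = 0 :=
                image_eq_zero_of_notMem_tsupport fun hm =>
                  hfar x hx hxS k hxk (tsupport_fderiv_subset ℝ hm)
              rw [this, norm_zero, zero_mul, mul_zero]
              exact mul_nonneg hM'0 (mul_nonneg (by positivity) (hind k))
  have hdy := eLpNorm_dyadic_le (c := 2 * C) (by positivity) hgrowth N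
  refine ⟨κ, hκ, ?_, ?_, ?_, ?_⟩
  · rw [eLpNorm_congr_ae (g := fun _ => (0 : ℝ)) (hmemν.mono fun x hx => by
      simp only [(hνone x hx.1 hx.2).1, sub_self])]
    simp
  · rw [eLpNorm_congr_ae (g := fun _ => (0 : E3)) (hmemν.mono fun x hx => (hνone x hx.1 hx.2).2)]
    simp
  · exact (eLpNorm_le_mul_eLpNorm_of_ae_le_mul (hbound.mono fun x hx => hx.1) 2).trans
      ((mul_le_mul' le_rfl hdy).trans hNε)
  · exact (eLpNorm_le_mul_eLpNorm_of_ae_le_mul (hbound.mono fun x hx => hx.2) 2).trans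
      ((mul_le_mul' le_rfl hdy).trans hNε)

/-! ### Extension by zero from either component -/

lemma surfaceMeasure_singleton {d : ℕ} (hd : 0 < d) (S : Set E3) (p : E3) :
    surfaceMeasure d S {p} = 0 := by
  refine le_antisymm ((Measure.restrict_apply_le _ _).trans ?_) zero_le
  have := Measure.nullSingletonClass_hausdorff E3 (d := d) (by exact_mod_cast hd)
  rw [Measure.euclideanHausdorffMeasure_def, Measure.smul_apply, measure_singleton, smul_zero]

lemma IsDensity.weightedMeasure_le {d : ℕ} {S : Set E3} {θ : E3 → ℝ} (h : IsDensity d S θ) :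
    ∃ C : ℝ≥0∞, C ≠ ⊤ ∧ weightedMeasure d S θ ≤ C • surfaceMeasure d S := by
  obtain ⟨-, c, C, -, hC⟩ := h
  refine ⟨ENNReal.ofReal C, ENNReal.ofReal_ne_top, ?_⟩
  rw [weightedMeasure, ← withDensity_const]
  exact withDensity_mono (hC.mono fun x hx => ENNReal.ofReal_le_ofReal hx.2)

lemma restrict_ball_eq_zero {d : ℕ} {S : Set E3} {p : E3} {r : ℝ}
    (h : Disjoint (Metric.ball p r) S) :
    (surfaceMeasure d S).restrict (Metric.ball p r) = 0 := by
  rw [surfaceMeasure, Measure.restrict_restrict measurableSet_ball, h.inter_eq,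
    Measure.restrict_empty]

lemma exists_disjoint_ball {S : Set E3} (hS : IsClosed S) {p : E3} (hp : p ∉ S) :
    ∃ r₀ > 0, ∀ r, r ≤ r₀ → Disjoint (Metric.ball p r) S := by
  obtain ⟨r₀, hr₀, h⟩ := Metric.isOpen_iff.1 hS.isOpen_compl p hp
  exact ⟨r₀, hr₀, fun r hr => Set.disjoint_left.2 fun x hx hxS =>
    h (Metric.ball_subset_ball hr hx) hxS⟩

lemma MemH1.exists_ambientH1 {d : ℕ} (hd : d = 1 ∨ d = 2) {S : Set E3} (hS : IsClosed S)
    {w : E3 → ℝ} (hw : MemH1 d S w) (p : E3) :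
    ∃ r₀ > 0, ∀ r, 0 < r → r ≤ r₀ →
      AmbientH1 ((surfaceMeasure d S).restrict (Metric.ball p r)) w := by
  by_cases hp : p ∈ S
  · obtain ⟨Φ, hΦ, hpΦ, hH1⟩ := hw.2 p hp
    obtain ⟨s, L, r₀, hr₀, h⟩ := hΦ.exists_chartBall hpΦ
    exact ⟨r₀, hr₀, fun r hr hrr => (h r hr hrr).ambientH1 hd hS.measurableSet hw.1 hH1⟩
  · obtain ⟨r₀, hr₀, h⟩ := exists_disjoint_ball hS hp
    refine ⟨r₀, hr₀, fun r _ hrr => ?_⟩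
    rw [restrict_ball_eq_zero (h r hrr)]
    exact (ambientH1_zero 0).congr_ae (by simp [Filter.EventuallyEq])

section CurveAndSurface

variable {S₁ S₂ : Set E3}

/-- A curve and a transversal surface meet in isolated points. -/
lemma Transversal.singleton_mem_nhdsWithin (hS₁ : IsCompactSubmanifold 1 S₁)
    (hS₂ : IsCompactSubmanifold 2 S₂) (hT : Transversal S₁ S₂) {p : E3} (hp : p ∈ S₁ ∩ S₂) :
    {p} ∈ 𝓝[S₁ ∩ S₂] p := by
  obtain ⟨Φ₁, h₁, hs₁⟩ := hS₁.exists_chart p hp.1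
  obtain ⟨Φ₂, h₂, hs₂⟩ := hS₂.exists_chart p hp.2
  obtain ⟨C, hC, hev⟩ := hT.exists_norm_sub_le h₁ h₂ hp.1 hp.2 hs₁ hs₂
  refine eventually_nhdsWithin_iff.2 ?_
  filter_upwards [hev, Φ₁.open_source.mem_nhds hs₁] with x hx hxs hxS
  have h0 : lastTwo (Φ₁ x) = 0 := by
    ext j
    exact ((h₁.slice x hxs).1 hxS.1).2 j.succ (by simp)
  have := hx hxS.2
  rw [h0, norm_zero, mul_zero] at this
  exact sub_eq_zero.1 (norm_le_zero_iff.1 this)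

lemma Transversal.surfaceMeasure_inter (hS₁ : IsCompactSubmanifold 1 S₁)
    (hS₂ : IsCompactSubmanifold 2 S₂) (hT : Transversal S₁ S₂) {d : ℕ} (hd : 0 < d) (S : Set E3) :
    surfaceMeasure d S (S₁ ∩ S₂) = 0 :=
  measure_null_of_locally_null _ fun p hp =>
    ⟨{p}, hT.singleton_mem_nhdsWithin hS₁ hS₂ hp, surfaceMeasure_singleton hd S p⟩

lemma Transversal.exists_hasCutoffs (hS₁ : IsCompactSubmanifold 1 S₁)
    (hS₂ : IsCompactSubmanifold 2 S₂) (hT : Transversal S₁ S₂) (p : E3) :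
    ∃ r₀ > 0, ∀ r, 0 < r → r ≤ r₀ →
      HasCutoffs ((surfaceMeasure 1 S₁).restrict (Metric.ball p r))
        ((surfaceMeasure 2 S₂).restrict (Metric.ball p r)) := by
  by_cases hp₁ : p ∈ S₁
  · by_cases hp₂ : p ∈ S₂
    · obtain ⟨Φ₁, h₁, hs₁⟩ := hS₁.exists_chart p hp₁
      obtain ⟨Φ₂, h₂, hs₂⟩ := hS₂.exists_chart p hp₂
      obtain ⟨C, hC, hev⟩ := hT.exists_norm_sub_le h₁ h₂ hp₁ hp₂ hs₁ hs₂
      obtain ⟨s₁, L₁, r₁, hr₁, hb₁⟩ := h₁.exists_chartBall hs₁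
      obtain ⟨s₂, L₂, r₂, hr₂, hb₂⟩ := h₂.exists_chartBall hs₂
      obtain ⟨r₃, hr₃, hb₃⟩ := Metric.eventually_nhds_iff_ball.1 hev
      refine ⟨min r₁ (min r₂ r₃), by positivity, fun r hr hrr => ?_⟩
      simp only [le_min_iff] at hrr
      exact hasCutoffs_of_chartBall hS₁.isCompact.measurableSet hS₂.isCompact.measurableSet
        (hb₁ r hr hrr.1) (hb₂ r hr hrr.2.1) hC
        fun x hx => hb₃ x (Metric.ball_subset_ball hrr.2.2 hx)
    · obtain ⟨r₀, hr₀, h⟩ := exists_disjoint_ball hS₂.isCompact.isClosed hp₂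
      refine ⟨r₀, hr₀, fun r _ hrr ε hε => ?_⟩
      obtain ⟨χ, hχ, hχ1⟩ := exists_isTest_one_on_ball p r
      have hmem : ∀ᵐ x ∂(surfaceMeasure 1 S₁).restrict (Metric.ball p r), x ∈ Metric.ball p r :=
        ae_restrict_mem measurableSet_ball
      rw [restrict_ball_eq_zero (S := S₂) (h r hrr)]
      refine ⟨χ, hχ, ?_, ?_, by simp, by simp⟩
      · rw [eLpNorm_congr_ae (g := fun _ => (0 : ℝ)) (hmem.mono fun x hx => by
          simp only [(hχ1 x hx).1, sub_self])]
        simp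
      · rw [eLpNorm_congr_ae (g := fun _ => (0 : E3)) (hmem.mono fun x hx => (hχ1 x hx).2)]
        simp
  · obtain ⟨r₀, hr₀, h⟩ := exists_disjoint_ball hS₁.isCompact.isClosed hp₁
    refine ⟨r₀, hr₀, fun r _ hrr ε _ => ⟨fun _ => 0, isTest_zero, ?_⟩⟩
    rw [restrict_ball_eq_zero (S := S₁) (h r hrr)]
    have : gradient (fun _ : E3 => (0 : ℝ)) = fun _ => 0 := by
      ext1 x; simp [gradient_eq_toDual_symm]
    simp [this]

end CurveAndSurface

/-- Extension by zero across a null intersection, given local cutoffs. -/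
lemma MemH1.ambientH1_extend_zero {d e : ℕ} (hd : d = 1 ∨ d = 2) {S T : Set E3} (hS : IsCompact S)
    (hT : IsCompact T) (hnS : surfaceMeasure d S (S ∩ T) = 0)
    (hnT : surfaceMeasure e T (S ∩ T) = 0)
    (hcut : ∀ p, ∃ r₀ > 0, ∀ r, 0 < r → r ≤ r₀ →
      HasCutoffs ((surfaceMeasure d S).restrict (Metric.ball p r))
        ((surfaceMeasure e T).restrict (Metric.ball p r)))
    {w u : E3 → ℝ} (hw : MemH1 d S w) (huS : ∀ x ∈ S \ T, u x = w x) (huT : ∀ x ∈ T \ S, u x = 0) :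
    AmbientH1 (surfaceMeasure d S + surfaceMeasure e T) u := by
  have hSm : ∀ᵐ x ∂surfaceMeasure d S, x ∈ S := ae_restrict_mem hS.measurableSet
  have hTm : ∀ᵐ x ∂surfaceMeasure e T, x ∈ T := ae_restrict_mem hT.measurableSet
  have hST : ∀ᵐ x ∂surfaceMeasure e T, x ∉ S := by
    filter_upwards [hTm, measure_eq_zero_iff_ae_notMem.1 hnT] with x hxT hx hxS
    exact hx ⟨hxS, hxT⟩
  have hu1 : u =ᵐ[surfaceMeasure d S] w := by
    filter_upwards [hSm, measure_eq_zero_iff_ae_notMem.1 hnS] with x hxS hx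
    exact huS x ⟨hxS, fun hxT => hx ⟨hxS, hxT⟩⟩
  have hu2 : u =ᵐ[surfaceMeasure e T] fun _ => 0 := by
    filter_upwards [hTm, hST] with x hxT hxS using huT x ⟨hxT, hxS⟩
  have hmem : MemLp u 2 (surfaceMeasure d S + surfaceMeasure e T) :=
    MemLp.add_measure (hw.1.ae_eq hu1.symm) (MemLp.zero'.ae_eq hu2.symm)
  refine AmbientH1.of_locally (hS.union hT) ?_ hmem fun p _ => ?_
  · exact ae_add_measure_iff.2 ⟨hSm.mono fun x hx => Or.inl hx, hTm.mono fun x hx => Or.inr hx⟩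
  obtain ⟨r₁, hr₁, h₁⟩ := hw.exists_ambientH1 hd hS.isClosed p
  obtain ⟨r₂, hr₂, h₂⟩ := hcut p
  have hr : 0 < min r₁ r₂ := lt_min hr₁ hr₂
  refine ⟨min r₁ r₂, hr, ?_⟩
  rw [Measure.restrict_add]
  exact (h₁ _ hr (min_le_left _ _)).extend_zero (ae_restrict_of_ae hSm) (ae_restrict_of_ae hST)
    (ae_restrict_of_ae hu1) (ae_restrict_of_ae hu2) (h₂ _ hr (min_le_right _ _))

/-- Both extensions by zero, for a curve `S₁` and a transversal surface `S₂`. -/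
lemma Transversal.ambientH1_extend_zero {S₁ S₂ : Set E3} (hS₁ : IsCompactSubmanifold 1 S₁)
    (hS₂ : IsCompactSubmanifold 2 S₂) (hT : Transversal S₁ S₂) :
    (∀ w, MemH1 1 S₁ w → ∀ u : E3 → ℝ, (∀ x ∈ S₁ \ S₂, u x = w x) → (∀ x ∈ S₂ \ S₁, u x = 0) →
      AmbientH1 (surfaceMeasure 1 S₁ + surfaceMeasure 2 S₂) u) ∧
    (∀ w, MemH1 2 S₂ w → ∀ u : E3 → ℝ, (∀ x ∈ S₁ \ S₂, u x = 0) → (∀ x ∈ S₂ \ S₁, u x = w x) →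
      AmbientH1 (surfaceMeasure 1 S₁ + surfaceMeasure 2 S₂) u) := by
  have hnull := fun (d : ℕ) (hd : 0 < d) S => hT.surfaceMeasure_inter hS₁ hS₂ (d := d) hd S
  refine ⟨fun w hw u h1 h2 => hw.ambientH1_extend_zero (Or.inl rfl) hS₁.isCompact hS₂.isCompact
    (hnull 1 one_pos _) (hnull 2 two_pos _) (hT.exists_hasCutoffs hS₁ hS₂) h1 h2,
    fun w hw u h1 h2 => ?_⟩
  rw [add_comm]
  refine hw.ambientH1_extend_zero (Or.inr rfl) hS₂.isCompact hS₁.isCompact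
    (Set.inter_comm S₁ S₂ ▸ hnull 2 two_pos _) (Set.inter_comm S₁ S₂ ▸ hnull 1 one_pos _)
    (fun p => ?_) h2 h1
  obtain ⟨r₀, hr₀, h⟩ := hT.exists_hasCutoffs hS₁ hS₂ p
  exact ⟨r₀, hr₀, fun r hr hrr => (h r hr hrr).symm (ae_restrict_mem measurableSet_ball)
    (ae_restrict_mem measurableSet_ball)⟩

lemma Transversal.symm {S T : Set E3} (h : Transversal S T) : Transversal T S := fun p hp => by
  rw [sup_comm]
  exact h p hp.symm

end LowDim

theorem proposition3p3
    (d₁ d₂ : ℕ) (hd₁ : d₁ = 1 ∨ d₁ = 2) (hd₂ : d₂ = 1 ∨ d₂ = 2) (hne : d₁ ≠ d₂)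
    (S₁ S₂ : Set LowDim.E3)
    (hS₁ : LowDim.IsCompactSubmanifold d₁ S₁) (hS₂ : LowDim.IsCompactSubmanifold d₂ S₂)
    (htrans : LowDim.Transversal S₁ S₂)
    (θ₁ θ₂ : LowDim.E3 → ℝ)
    (hθ₁ : LowDim.IsDensity d₁ S₁ θ₁) (hθ₂ : LowDim.IsDensity d₂ S₂ θ₂)
    (μ : MeasureTheory.Measure LowDim.E3)
    (hμ : μ = LowDim.weightedMeasure d₁ S₁ θ₁ + LowDim.weightedMeasure d₂ S₂ θ₂) :
    (∀ w : LowDim.E3 → ℝ, LowDim.MemH1 d₁ S₁ w →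
      ∀ u : LowDim.E3 → ℝ, (∀ x ∈ S₁ \ S₂, u x = w x) → (∀ x ∈ S₂ \ S₁, u x = 0) →
        LowDim.MemH1mu μ u) ∧
    (∀ w : LowDim.E3 → ℝ, LowDim.MemH1 d₂ S₂ w →
      ∀ v : LowDim.E3 → ℝ, (∀ x ∈ S₁ \ S₂, v x = 0) → (∀ x ∈ S₂ \ S₁, v x = w x) →
        LowDim.MemH1mu μ v) := by
  open LowDim in
  obtain ⟨C₁, hC₁, hle₁⟩ := hθ₁.weightedMeasure_le
  obtain ⟨C₂, hC₂, hle₂⟩ := hθ₂.weightedMeasure_le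
  have hμle : μ ≤ max C₁ C₂ • (surfaceMeasure d₁ S₁ + surfaceMeasure d₂ S₂) := by
    rw [hμ, smul_add]
    refine add_le_add (hle₁.trans ?_) (hle₂.trans ?_) <;>
    · refine Measure.le_iff.2 fun s _ => ?_
      simp only [Measure.smul_apply, smul_eq_mul]
      gcongr
      simp
  have key : ∀ u, AmbientH1 (surfaceMeasure d₁ S₁ + surfaceMeasure d₂ S₂) u → MemH1mu μ u :=
    fun u hu => (hu.of_le_smul (max_lt hC₁.lt_top hC₂.lt_top).ne hμle).memH1mu
  rcases hd₁ with rfl | rfl <;> rcases hd₂ with rfl | rfl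
  · exact absurd rfl hne
  · obtain ⟨h1, h2⟩ := htrans.ambientH1_extend_zero hS₁ hS₂
    exact ⟨fun w hw u hu hu' => key u (h1 w hw u hu hu'),
      fun w hw v hv hv' => key v (h2 w hw v hv hv')⟩
  · obtain ⟨h1, h2⟩ := htrans.symm.ambientH1_extend_zero hS₂ hS₁
    rw [add_comm] at h1 h2
    exact ⟨fun w hw u hu hu' => key u (h2 w hw u hu' hu),
      fun w hw v hv hv' => key v (h1 w hw v hv' hv)⟩
  · exact absurd rfl hne
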